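/- **Market.** Let $\mathcal N=\{1,\dots,n\}$ be a set of nodes and $\mathcal E\subseteq \mathcal N\times\mathcal N$ a set of lanes (self-loops allowed). For each lane $(i,j)\in\mathcal E$ there are given: a set $R_{ij}\subseteq\mathbb R$ of admissible shipper prices and a demand function $d_{ij}$ that is nonnegative and strictly decreasing on $R_{ij}$, with inverse $r_{ij}(\cdot):d_{ij}(R_{ij})\to R_{ij}$; a carrier arrival rate $\lambda_{ij}>0$; a probability $q_{ij}\ge 0$, with $\sum_{k:(j,k)\in\mathcal E}q_{jk}\le 1$ for every node $j$; a unit penalty $b_{ij}\in\mathbb R$; and the law of a carrier's opportunity cost, which lives on $[0,\infty)$, has a density, and whose distribution function $F_{ij}$ is strictly increasing where $0<F_{ij}<1$, with inverse $F_{ij}^{-1}$, understood as the quantile function $F_{ij}^{-1}(x)=\inf\{c\ge 0:F_{ij}(c)\ge x\}$. **Fluid problem** ($\mathsf{FA}$). Maximize $$\sum_{(i,j)\in\mathcal E} r_{ij}(d_{ij})d_{ij}-F_{ij}^{-1}\!\left(\frac{\bar y_{ij}}{\bar\lambda_{ij}}\right)\bar y_{ij}-b_{ij}(d_{ij}-\bar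 y_{ij})$$ over $(\mathbf d,\bar{\mathbf y},\bar{\boldsymbol\lambda})\ge 0$ subject to $\sum_{k:(k,i)\in\mathcal E}q_{ij}\bar y_{ki}+\lambda_{ij}=\bar\lambda_{ij}$, $\bar y_{ij}\le d_{ij}$ and $\bar y_{ij}\le\bar\lambda_{ij}$ for all $(i,j)\in\mathcal E$, where $d_{ij}$ has to be in the range of the demand function, $d_{ij}\in d_{ij}(R_{ij})$, and $\bar y_{ij}/\bar\lambda_{ij}$ in the range of $F_{ij}$. For $\theta\in\{1,2,\dots\}$, the $\theta$-scaled market has demand functions $\theta d_{ij}(\cdot)$ and arrival rates $\theta\lambda_{ij}$, all other data being unchanged; $\gamma^{\mathsf{FA}}(\theta)$ denotes the optimal value of its fluid problem. Assume that the fluid problem with $\theta=1$ has an optimal solution $(\mathbf d^*,\bar{\mathbf y}^*,\bar{\boldsymbol\lambda}^*)$ and that its optimal value is positive. **Static posted prices** ($\mathsf{SP}$). Let $r^*_{ij}=r_{ij}(d^*_{ij})$ and $p^*_{ij}=F_{ij}^{-1}(\bar y^*_{ij}/\bar\lambda^*_{ij})$. In the $\theta$-scaled market under $\mathsf{SP}$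 the state $(\mathbf S_t,\mathbf D_t)$ (numbers of available carriers and of loads on each lane) is the following Markov chain. Each of the $S_{ijt}$ carriers on lane $(i,j)$ draws an independent opportunity cost from the law $F_{ij}$ and wants to book iff it is at most $p^*_{ij}$; let $X_{ijt}$ be the number of these carriers and $Y_{ijt}=\min(X_{ijt},D_{ijt})$ the number of loads transported. Each carrier who has transported a load to node $j$ becomes, independently, available on lane $(j,k)$ with probability $q_{jk}$ and leaves otherwise; all other carriers leave. With $Z_{ijt}$ the number of carriers who so become available on lane $(i,j)$, $S_{ij,t+1}=Z_{ijt}+\Lambda_{ij,t+1}$, where the $\Lambda_{ij,t+1}\sim\mathrm{Poisson}(\theta\lambda_{ij})$ and $D_{ij,t+1}\sim\mathrm{Poisson}(\theta d_{ij}(r^*_{ij}))$ are independent of each other and of the past. The expected profit of period $t$ is $$G(\mathbf S_t,\mathbf D_t)=\mathrm E\Big[\sum_{(i,j)\in\mathcal E}\theta r^*_{ij}d_{ij}(r^*_{ij})-b_{ij}(D_{ijt}-Y_{ijt})-p^*_{ij}Y_{ijt}\,\Big|\,\mathbf S_t,\mathbf D_t\Big].$$ **Theorem.** For every $\theta\in\{1,2,\dots\}$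 the long-run average profit $\gamma^{\mathsf{SP}}(\theta)=\lim_{T\to\infty}\frac1T\sum_{t=1}^T\mathrm E[G(\mathbf S_t,\mathbf D_t)]$ exists and is the same for all initial states. There is a constant $C$, independent of $\theta$, such that $$\gamma^{\mathsf{FA}}(\theta)-\gamma^{\mathsf{SP}}(\theta)\le C\sqrt\theta\qquad\text{for all }\theta\in\{1,2,\dots\},$$ and $\gamma^{\mathsf{SP}}(\theta)/\gamma^{\mathsf{FA}}(\theta)=1-O(1/\sqrt\theta)\to 1$ as $\theta\to\infty$. -/

import Mathlib

open MeasureTheory ProbabilityTheory Filter Topology Asymptotics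

noncomputable section

/-- The primitives of a freight marketplace on a network with nodes `Fin n` and set of lanes
(origin-destination arcs, self-loops allowed) `E`. -/
structure FreightMarket {n : ℕ} (E : Finset (Fin n × Fin n)) where
  /-- admissible shipper prices on each lane -/
  priceSet : E → Set ℝ
  /-- demand rate on a lane as a function of the shipper price -/
  demand : E → ℝ → ℝ
  /-- rate of exogenous carrier arrivals -/
  arrival : E → ℝ
  /-- `stay (j,k)` is the probability that a carrier who has just delivered a load to node `j`
  stays in the marketplace and is available on lane `(j,k)` in the next period -/
  stay : E → ℝ
  /-- penalty per unmatched load -/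
  penalty : E → ℝ
  /-- law of a carrier's opportunity cost -/
  costLaw : E → Measure ℝ

/-- A candidate `(d, ȳ, λ̄)` of the fluid problem. -/
structure FluidPoint {n : ℕ} (E : Finset (Fin n × Fin n)) where
  d : E → ℝ
  y : E → ℝ
  lam : E → ℝ

/-- A system state `(S, D)`: available carriers and loads on each lane. -/
abbrev FreightState {n : ℕ} (E : Finset (Fin n × Fin n)) : Type := (E → ℕ) × (E → ℕ)

namespace FreightMarket

variable {n : ℕ} {E : Finset (Fin n × Fin n)} (M : FreightMarket E)

/-- The cumulative distribution function `F` of the opportunity cost. -/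
def costCDF (e : E) (c : ℝ) : ℝ := cdf (M.costLaw e) c

/-- `F⁻¹`, as the quantile function on the nonnegative half line (costs are nonnegative). -/
def costQuantile (e : E) (x : ℝ) : ℝ := sInf {c : ℝ | 0 ≤ c ∧ x ≤ M.costCDF e c}

/-- The inverse demand function `r_e(d)`. -/
def invDemand (e : E) (d : ℝ) : ℝ := Function.invFunOn (M.demand e) (M.priceSet e) d

/-- Standing assumptions on the primitives. -/
structure IsRegular : Prop where
  demand_nonneg : ∀ e, ∀ r ∈ M.priceSet e, 0 ≤ M.demand e r
  demand_strictAnti : ∀ e, StrictAntiOn (M.demand e) (M.priceSet e)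
  arrival_pos : ∀ e, 0 < M.arrival e
  stay_nonneg : ∀ e, 0 ≤ M.stay e
  stay_sum_le_one : ∀ j : Fin n, ∑ e : E with e.1.1 = j, M.stay e ≤ 1
  cost_prob : ∀ e, IsProbabilityMeasure (M.costLaw e)
  cost_nonneg : ∀ e, M.costLaw e (Set.Iio 0) = 0
  cost_density : ∀ e, M.costLaw e ≪ volume
  cost_strictMono : ∀ e,
    StrictMonoOn (M.costCDF e) {c | 0 < M.costCDF e c ∧ M.costCDF e c < 1}

/-- The market in which demand rates and carrier arrival rates are multiplied by `θ`. -/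
def scale (θ : ℝ) : FreightMarket E :=
  { M with
    demand := fun e r => θ * M.demand e r
    arrival := fun e => θ * M.arrival e }

/-! ### The fluid problem -/

/-- The constraints of the fluid problem. The two membership conditions say that the prices
`r_e(d_e)` and `F_e⁻¹(ȳ_e / λ̄_e)` occurring in the objective exist. -/
structure FluidFeasible (z : FluidPoint E) : Prop where
  flow : ∀ e : E, (∑ k : E with k.1.2 = e.1.1, M.stay e * z.y k) + M.arrival e = z.lam e
  y_le_d : ∀ e, z.y e ≤ z.d e
  y_le_lam : ∀ e, z.y e ≤ z.lam e
  y_nonneg : ∀ e, 0 ≤ z.y e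
  lam_nonneg : ∀ e, 0 ≤ z.lam e
  d_nonneg : ∀ e, 0 ≤ z.d e
  d_mem : ∀ e, z.d e ∈ M.demand e '' M.priceSet e
  ratio_mem : ∀ e, z.y e / z.lam e ∈ Set.range (M.costCDF e)

/-- The objective of the fluid problem. -/
def fluidObjective (z : FluidPoint E) : ℝ :=
  ∑ e, (M.invDemand e (z.d e) * z.d e
    - M.costQuantile e (z.y e / z.lam e) * z.y e
    - M.penalty e * (z.d e - z.y e))

/-- `z` is an optimal solution of the fluid problem. -/
def IsFluidOptimal (z : FluidPoint E) : Prop :=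
  M.FluidFeasible z ∧ ∀ z', M.FluidFeasible z' → M.fluidObjective z' ≤ M.fluidObjective z

/-- The optimal value `γ^FA` of the fluid problem. -/
def fluidValue : ℝ := sSup (M.fluidObjective '' {z | M.FluidFeasible z})

/-- Shipper prices `r*` read off from a fluid solution. -/
def shipperPrice (z : FluidPoint E) (e : E) : ℝ := M.invDemand e (z.d e)

/-- Carrier payments `p*` read off from a fluid solution. -/
def carrierPrice (z : FluidPoint E) (e : E) : ℝ := M.costQuantile e (z.y e / z.lam e)

/-! ### The Markov chain under static posted prices `r` (shippers) and `p` (carriers) -/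

/-- Law of the number `X` of carriers who want to book on each lane: the carriers have independent
opportunity costs, and a carrier wants to book iff his cost is at most the posted price. -/
def bookingLaw (p : E → ℝ) (S : E → ℕ) : Measure (E → ℕ) :=
  (Measure.pi fun s : (Σ e : E, Fin (S e)) => M.costLaw s.1).map
    fun c e => Fintype.card {s : Fin (S e) // c ⟨e, s⟩ ≤ p e}

/-- The number `Y = min (X, D)` of loads transported on each lane. -/
def shipped (X D : E → ℕ) (e : E) : ℕ := min (X e) (D e)

/-- Next move of one carrier who has just arrived loaded at node `j`: a unit vector for the lane
out of `j` on which he becomes available, or `0` if he leaves the marketplace. -/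
def routeLaw (j : Fin n) : Measure (E → ℕ) :=
  (∑ e : E with e.1.1 = j, ENNReal.ofReal (M.stay e) • Measure.dirac (Pi.single e 1)) +
    ENNReal.ofReal (1 - ∑ e : E with e.1.1 = j, M.stay e) • Measure.dirac 0

/-- Law of the numbers `Z` of returning carriers, given the numbers `Y` of transported loads:
the carriers move independently, so that `(Z_{jk})_k` is multinomial for each node `j`. -/
def returnLaw (Y : E → ℕ) : Measure (E → ℕ) :=
  (Measure.pi fun s : (Σ e : E, Fin (Y e)) => M.routeLaw s.1.1.2).map fun v => ∑ s, v s

/-- Law of the exogenous carrier arrivals `Λ`: independent Poisson variables. -/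
def arrivalLaw : Measure (E → ℕ) :=
  Measure.pi fun e => poissonMeasure (M.arrival e).toNNReal

/-- Law of the new loads under shipper prices `r`: independent Poisson variables. -/
def demandLaw (r : E → ℝ) : Measure (E → ℕ) :=
  Measure.pi fun e => poissonMeasure (M.demand e (r e)).toNNReal

/-- One-step transition law from a state `(S, D)`: the next state is `(Z + Λ, D')`. -/
def stepLaw (r p : E → ℝ) (σ : FreightState E) : Measure (FreightState E) :=
  (M.bookingLaw p σ.1).bind fun X =>
    (((M.returnLaw (shipped X σ.2)).prod M.arrivalLaw).map fun w => w.1 + w.2).prod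
      (M.demandLaw r)

/-- Law of the state after `t` transitions from the initial state `σ`. -/
def stateLaw (r p : E → ℝ) (σ : FreightState E) : ℕ → Measure (FreightState E)
  | 0 => Measure.dirac σ
  | t + 1 => (stateLaw r p σ t).bind (M.stepLaw r p)

/-- Expected one-period profit `G(S, D)`. -/
def expectedProfit (r p : E → ℝ) (σ : FreightState E) : ℝ :=
  ∫ X, ∑ e, (r e * M.demand e (r e)
      - M.penalty e * ((σ.2 e : ℝ) - (shipped X σ.2 e : ℝ))
      - p e * (shipped X σ.2 e : ℝ)) ∂(M.bookingLaw p σ.1)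

/-- `γ` is the long-run average profit per period under static prices `(r, p)`: whatever the
initial state, `(1/T) ∑_{t ≤ T} E[G(S_t, D_t)]` is well defined and converges to `γ`. -/
def IsLongRunAverageProfit (r p : E → ℝ) (γ : ℝ) : Prop :=
  ∀ σ : FreightState E,
    (∀ t, Integrable (M.expectedProfit r p) (M.stateLaw r p σ t)) ∧
    Tendsto (fun T : ℕ =>
        (∑ t ∈ Finset.range T, ∫ τ, M.expectedProfit r p τ ∂(M.stateLaw r p σ t)) / (T : ℝ))
      atTop (𝓝 γ)

end FreightMarket

end

/-! ### Integrals over product, Poisson and composed measures. -/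

section Auxiliary

open scoped NNReal ENNReal

/-! At the posted prices a carrier accepts with probability `y / lam`, so the chain would have
exactly the fluid flows as means if every willing carrier found a load. The expected profit of a
period is affine in the mean numbers of loads and of shipments (`expectedProfit_eq`), so the gap to
the fluid value is a weighted sum of the shortfalls `y - E Y`. These originate in the initial
transient and in the excess `E (X - D)⁺` of bookings over loads.

Excess: from the empty state, the generating function of the carriers at `1 + x` is at most `exp (∑
lam x)`, that of independent Poisson variables with the fluid means
(`lintegral_prod_pow_stateLaw_le`). Thinning, routing and Poisson arrivals reproduce this
exponential by flow balance, and lost bookings only lower it. Since `D` is Poisson and independent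
of `X`, and `y ≤ d`, one gets `E (X - D)⁺ ≤ s⁻¹ E exp (s (X - D)) ≤ s⁻¹ exp (2 d s²)`. For `d` of
order `θ` and `s = 1/√θ` this is of order `√θ`.

Propagation: a shortfall on one lane reduces the returning carriers on the next lanes, but exogenous
arrivals supply at least a fraction `η` of every `lam`. The relative shortfall therefore contracts
by `1 - η` per period and settles at order `1/√θ` (`sub_shippedMean_le`).

Ergodicity: a period without loads has a fixed positive probability and erases the past, which gives
a Doeblin contraction (`exists_tendsto_expectedProfit`). The limit is independent of the start, so
estimates from the empty state suffice. Finally, the fluid problem is homogeneous of degree one, so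
its value is `θ` times the value at `θ = 1`. -/

lemma lintegral_pi_prod {ι : Type*} [Fintype ι] {α : ι → Type*} [∀ i, MeasurableSpace (α i)]
    (μ : ∀ i, Measure (α i)) [∀ i, IsProbabilityMeasure (μ i)] {f : ∀ i, α i → ℝ≥0∞}
    (hf : ∀ i, Measurable (f i)) :
    ∫⁻ x, ∏ i, f i (x i) ∂(Measure.pi μ) = ∏ i, ∫⁻ x, f i x ∂(μ i) := by
  refine (lintegral_prod_eq_prod_lintegral_of_indepFun Finset.univ
    (fun i (x : ∀ i, α i) => f i (x i)) (iIndepFun_pi fun i => (hf i).aemeasurable)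
    (fun i => (hf i).comp (measurable_pi_apply i))).trans ?_
  exact Finset.prod_congr rfl fun i _ => (measurePreserving_eval μ i).lintegral_comp (hf i)

lemma lintegral_pi_eval {ι : Type*} [Fintype ι] {α : ι → Type*} [∀ i, MeasurableSpace (α i)]
    (μ : ∀ i, Measure (α i)) [∀ i, IsProbabilityMeasure (μ i)] (i : ι) {f : α i → ℝ≥0∞}
    (hf : Measurable f) : ∫⁻ x, f (x i) ∂(Measure.pi μ) = ∫⁻ x, f x ∂(μ i) :=
  (measurePreserving_eval μ i).lintegral_comp hf

lemma lintegral_poissonMeasure (r : ℝ≥0) (f : ℕ → ℝ≥0∞) :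
    ∫⁻ k, f k ∂(poissonMeasure r)
      = ∑' k : ℕ, ENNReal.ofReal (Real.exp (-r) * r ^ k / k.factorial) * f k := by
  rw [poissonMeasure, lintegral_sum_measure]
  simp [lintegral_smul_measure]

lemma lintegral_poissonMeasure_pow (r w : ℝ≥0) :
    ∫⁻ k, (w : ℝ≥0∞) ^ k ∂(poissonMeasure r) = ENNReal.ofReal (Real.exp (r * (w - 1))) := by
  rw [lintegral_poissonMeasure]
  have hs : HasSum (fun k : ℕ => Real.exp (-r) * (r ^ k / k.factorial * w ^ k))
      (Real.exp (r * (w - 1))) := by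
    have h := (NormedSpace.expSeries_div_hasSum_exp ((r * w : ℝ))).mul_left (Real.exp (-r))
    rw [← Real.exp_eq_exp_ℝ, ← Real.exp_add] at h
    have h2 : -(r : ℝ) + r * w = r * (w - 1) := by ring
    rw [h2] at h
    refine h.congr_fun fun k => ?_
    rw [mul_pow]; ring
  rw [← hs.tsum_eq, ENNReal.ofReal_tsum_of_nonneg (fun k => by positivity) hs.summable]
  refine tsum_congr fun k => ?_
  rw [← ENNReal.ofReal_coe_nnreal (p := w), ← ENNReal.ofReal_pow (by positivity),
    ← ENNReal.ofReal_mul (by positivity)]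
  congr 1
  ring

lemma lintegral_poissonMeasure_natCast (r : ℝ≥0) :
    ∫⁻ k, (k : ℝ≥0∞) ∂(poissonMeasure r) = r := by
  rw [lintegral_poissonMeasure, tsum_eq_zero_add' ENNReal.summable]
  have h (k : ℕ) : ENNReal.ofReal (Real.exp (-r) * r ^ (k + 1) / (k + 1).factorial)
      * ((k + 1 : ℕ) : ℝ≥0∞)
      = r * (ENNReal.ofReal (Real.exp (-r) * r ^ k / k.factorial) * 1) := by
    rw [← ENNReal.ofReal_natCast, ← ENNReal.ofReal_mul (by positivity),
      ← ENNReal.ofReal_coe_nnreal (p := r), mul_one, ← ENNReal.ofReal_mul (by positivity)]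
    congr 1
    rw [Nat.factorial_succ]
    push_cast
    field_simp
    simp [pow_succ, mul_comm]
  simp_rw [h]
  rw [ENNReal.tsum_mul_left, ← lintegral_poissonMeasure]
  simp

lemma integral_bind_of_integrable {α β : Type*} [MeasurableSpace α] [MeasurableSpace β]
    {μ : Measure α} {κ : α → Measure β} (hκ : Measurable κ) {f : β → ℝ}
    (hf : Integrable f (μ.bind κ)) : ∫ y, f y ∂(μ.bind κ) = ∫ x, ∫ y, f y ∂(κ x) ∂μ := by
  have h := Kernel.integral_comp (κ := Kernel.const Unit μ) (η := ⟨κ, hκ⟩) (a := ()) (f := f)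
    (by simpa [Kernel.comp_apply] using hf)
  simpa [Kernel.comp_apply] using h

end Auxiliary

namespace FreightMarket

open scoped NNReal ENNReal

variable {n : ℕ} {E : Finset (Fin n × Fin n)} {M : FreightMarket E}

/-! ### Generating functions and means of the one-period laws. -/

/-- The probability that a carrier accepts the posted price. -/
noncomputable def acceptProb (M : FreightMarket E) (p : E → ℝ) (e : E) : ℝ≥0 :=
  (M.costLaw e (Set.Iic (p e))).toNNReal

lemma IsRegular.coe_acceptProb (hM : M.IsRegular) (p : E → ℝ) (e : E) :
    (M.acceptProb p e : ℝ≥0∞) = M.costLaw e (Set.Iic (p e)) := by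
  have := hM.cost_prob e
  exact ENNReal.coe_toNNReal (measure_ne_top _ _)

lemma measurable_bookings (p : E → ℝ) (S : E → ℕ) :
    Measurable fun (c : (Σ e : E, Fin (S e)) → ℝ) (e : E) =>
      Fintype.card {s : Fin (S e) // c ⟨e, s⟩ ≤ p e} := by
  refine measurable_pi_lambda _ fun e => ?_
  simp_rw [Fintype.card_subtype, Finset.card_filter]
  refine Finset.measurable_sum _ fun s _ => ?_
  exact Measurable.ite (measurableSet_le (measurable_pi_apply _) measurable_const)
    measurable_const measurable_const

lemma IsRegular.isProbabilityMeasure_bookingLaw (hM : M.IsRegular) (p : E → ℝ) (S : E → ℕ) :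
    IsProbabilityMeasure (M.bookingLaw p S) := by
  have := hM.cost_prob
  exact Measure.isProbabilityMeasure_map (measurable_bookings p S).aemeasurable

/-- Independent thinning: one carrier contributes `1 + x` with the acceptance probability and `1`
otherwise. Evaluating generating functions at `1 + x` makes thinning the linear map `x ↦ α x`. -/
lemma IsRegular.lintegral_prod_pow_bookingLaw (hM : M.IsRegular) (p : E → ℝ) (S : E → ℕ)
    (x : E → ℝ≥0) :
    ∫⁻ X, ∏ e, (1 + x e : ℝ≥0∞) ^ X e ∂(M.bookingLaw p S)
      = ∏ e, (1 + (M.acceptProb p e * x e : ℝ≥0) : ℝ≥0∞) ^ S e := by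
  have := hM.cost_prob
  rw [bookingLaw, lintegral_map .of_discrete (measurable_bookings p S)]
  have h1 (c : (Σ e : E, Fin (S e)) → ℝ) :
      ∏ e, (1 + x e : ℝ≥0∞) ^ Fintype.card {s : Fin (S e) // c ⟨e, s⟩ ≤ p e}
        = ∏ s : (Σ e : E, Fin (S e)),
          (1 + (Set.Iic (p s.1)).indicator (fun _ => (x s.1 : ℝ≥0∞)) (c s)) := by
    rw [Fintype.prod_sigma]
    refine Finset.prod_congr rfl fun e _ => ?_
    rw [Fintype.card_subtype, ← Finset.prod_const, Finset.prod_filter]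
    refine Finset.prod_congr rfl fun s _ => ?_
    by_cases h : c ⟨e, s⟩ ≤ p e <;> simp [h]
  simp_rw [h1]
  rw [lintegral_pi_prod (fun s : (Σ e : E, Fin (S e)) => M.costLaw s.1)
    (f := fun s c => 1 + (Set.Iic (p s.1)).indicator (fun _ => (x s.1 : ℝ≥0∞)) c)
    (fun s => measurable_const.add (measurable_const.indicator measurableSet_Iic)),
    Fintype.prod_sigma]
  refine Finset.prod_congr rfl fun e _ => ?_
  simp_rw [lintegral_add_left (measurable_const (a := (1 : ℝ≥0∞))),
    lintegral_indicator_const measurableSet_Iic, ← hM.coe_acceptProb]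
  simp [mul_comm]

lemma IsRegular.lintegral_eval_bookingLaw (hM : M.IsRegular) (p : E → ℝ) (S : E → ℕ) (e : E) :
    ∫⁻ X, (X e : ℝ≥0∞) ∂(M.bookingLaw p S) = M.acceptProb p e * S e := by
  have := hM.cost_prob
  rw [bookingLaw, lintegral_map .of_discrete (measurable_bookings p S)]
  have h1 (c : (Σ e : E, Fin (S e)) → ℝ) :
      ((Fintype.card {s : Fin (S e) // c ⟨e, s⟩ ≤ p e} : ℕ) : ℝ≥0∞)
        = ∑ s : Fin (S e), (Set.Iic (p e)).indicator (fun _ => (1 : ℝ≥0∞)) (c ⟨e, s⟩) := by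
    rw [Fintype.card_subtype, Finset.card_filter]
    push_cast
    refine Finset.sum_congr rfl fun s _ => ?_
    by_cases h : c ⟨e, s⟩ ≤ p e <;> simp [h]
  simp_rw [h1]
  have hm : Measurable ((Set.Iic (p e)).indicator fun _ => (1 : ℝ≥0∞)) :=
    measurable_const.indicator measurableSet_Iic
  rw [lintegral_finsetSum Finset.univ (f := fun (s : Fin (S e)) (c : (Σ e : E, Fin (S e)) → ℝ) =>
    (Set.Iic (p e)).indicator (fun _ => (1 : ℝ≥0∞)) (c ⟨e, s⟩))
    fun s _ => hm.comp (measurable_pi_apply _)]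
  simp_rw [lintegral_pi_eval (fun s : (Σ e : E, Fin (S e)) => M.costLaw s.1) ⟨e, _⟩ hm]
  rw [lintegral_indicator_const measurableSet_Iic, ← hM.coe_acceptProb]
  simp [mul_comm]

lemma lintegral_routeLaw (j : Fin n) (f : (E → ℕ) → ℝ≥0∞) :
    ∫⁻ v, f v ∂(M.routeLaw j) = ∑ e : E with e.1.1 = j, (M.stay e).toNNReal * f (Pi.single e 1)
      + ENNReal.ofReal (1 - ∑ e : E with e.1.1 = j, M.stay e) * f 0 := by
  rw [routeLaw, lintegral_add_measure, lintegral_finsetSum_measure]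
  simp only [lintegral_smul_measure, lintegral_dirac, smul_eq_mul]
  rfl

lemma IsRegular.sum_stay_add (hM : M.IsRegular) (j : Fin n) :
    ∑ e : E with e.1.1 = j, ((M.stay e).toNNReal : ℝ≥0∞)
      + ENNReal.ofReal (1 - ∑ e : E with e.1.1 = j, M.stay e) = 1 := by
  have h : ∑ e : E with e.1.1 = j, ((M.stay e).toNNReal : ℝ≥0∞)
      = ENNReal.ofReal (∑ e : E with e.1.1 = j, M.stay e) :=
    (ENNReal.ofReal_sum_of_nonneg fun e _ => hM.stay_nonneg e).symm
  rw [h, ← ENNReal.ofReal_add (Finset.sum_nonneg fun e _ => hM.stay_nonneg e)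
    (sub_nonneg.2 (hM.stay_sum_le_one j))]
  simp

lemma IsRegular.isProbabilityMeasure_routeLaw (hM : M.IsRegular) (j : Fin n) :
    IsProbabilityMeasure (M.routeLaw j) := by
  refine ⟨?_⟩
  rw [← lintegral_one, lintegral_routeLaw]
  simpa using hM.sum_stay_add j

/-- A carrier joins at most one lane, so the generating function is affine in `x`; leaving
contributes to the constant term `1`. -/
lemma IsRegular.lintegral_prod_pow_routeLaw (hM : M.IsRegular) (j : Fin n) (x : E → ℝ≥0) :
    ∫⁻ v, ∏ e, (1 + x e : ℝ≥0∞) ^ v e ∂(M.routeLaw j)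
      = 1 + (∑ e : E with e.1.1 = j, (M.stay e).toNNReal * x e : ℝ≥0) := by
  have h (e : E) : ∏ i, (1 + x i : ℝ≥0∞) ^ (Pi.single e 1 : E → ℕ) i = 1 + x e := by
    rw [Finset.prod_eq_single e] <;> simp +contextual
  rw [lintegral_routeLaw]
  simp_rw [h, mul_add, mul_one, Finset.sum_add_distrib]
  simp_rw [Pi.zero_apply, pow_zero, Finset.prod_const_one, mul_one]
  rw [add_right_comm, hM.sum_stay_add j]
  push_cast
  rfl

lemma lintegral_eval_routeLaw (j : Fin n) (e : E) :
    ∫⁻ v, (v e : ℝ≥0∞) ∂(M.routeLaw j) = if e.1.1 = j then ((M.stay e).toNNReal : ℝ≥0∞) else 0 := by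
  rw [lintegral_routeLaw]
  simp [Pi.single_apply, Finset.sum_ite_eq]

lemma IsRegular.isProbabilityMeasure_returnLaw (hM : M.IsRegular) (Y : E → ℕ) :
    IsProbabilityMeasure (M.returnLaw Y) := by
  have := hM.isProbabilityMeasure_routeLaw
  exact Measure.isProbabilityMeasure_map Measurable.of_discrete.aemeasurable

lemma IsRegular.lintegral_prod_pow_returnLaw (hM : M.IsRegular) (Y : E → ℕ) (x : E → ℝ≥0) :
    ∫⁻ Z, ∏ e, (1 + x e : ℝ≥0∞) ^ Z e ∂(M.returnLaw Y)
      = ∏ k : E, (1 + (∑ e : E with e.1.1 = k.1.2, (M.stay e).toNNReal * x e : ℝ≥0) : ℝ≥0∞)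
          ^ Y k := by
  have := hM.isProbabilityMeasure_routeLaw
  rw [returnLaw, lintegral_map .of_discrete .of_discrete]
  have h1 (v : (Σ e : E, Fin (Y e)) → E → ℕ) : ∏ e, (1 + x e : ℝ≥0∞) ^ (∑ s, v s) e
      = ∏ s, ∏ e, (1 + x e : ℝ≥0∞) ^ v s e := by
    rw [Finset.prod_comm]
    simp [Finset.prod_pow_eq_pow_sum]
  simp_rw [h1]
  rw [lintegral_pi_prod (fun s : (Σ e : E, Fin (Y e)) => M.routeLaw s.1.1.2)
    (f := fun s v => ∏ e, (1 + x e : ℝ≥0∞) ^ v e) (fun s => .of_discrete), Fintype.prod_sigma]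
  refine Finset.prod_congr rfl fun k _ => ?_
  simp_rw [hM.lintegral_prod_pow_routeLaw]
  simp

lemma IsRegular.lintegral_eval_returnLaw (hM : M.IsRegular) (Y : E → ℕ) (e : E) :
    ∫⁻ Z, (Z e : ℝ≥0∞) ∂(M.returnLaw Y)
      = ∑ k : E with k.1.2 = e.1.1, (M.stay e).toNNReal * (Y k : ℝ≥0∞) := by
  have := hM.isProbabilityMeasure_routeLaw
  rw [returnLaw, lintegral_map .of_discrete .of_discrete]
  simp_rw [Finset.sum_apply, Nat.cast_sum]
  rw [lintegral_finsetSum _ fun s _ => .of_discrete]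
  simp_rw [lintegral_pi_eval (fun s : (Σ e : E, Fin (Y e)) => M.routeLaw s.1.1.2) _
    (f := fun v => (v e : ℝ≥0∞)) .of_discrete, lintegral_eval_routeLaw]
  rw [Fintype.sum_sigma, Finset.sum_filter]
  refine Finset.sum_congr rfl fun k _ => ?_
  by_cases h : k.1.2 = e.1.1
  · simp [h, mul_comm]
  · simp [h, Ne.symm h]

instance (M : FreightMarket E) : IsProbabilityMeasure M.arrivalLaw := by
  unfold arrivalLaw; infer_instance

instance (M : FreightMarket E) (r : E → ℝ) : IsProbabilityMeasure (M.demandLaw r) := by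
  unfold demandLaw; infer_instance

lemma IsRegular.lintegral_prod_pow_arrivalLaw (hM : M.IsRegular) (x : E → ℝ≥0) :
    ∫⁻ A, ∏ e, (1 + x e : ℝ≥0∞) ^ A e ∂M.arrivalLaw
      = ENNReal.ofReal (Real.exp (∑ e, M.arrival e * x e)) := by
  rw [arrivalLaw, lintegral_pi_prod _ (f := fun e k => (1 + x e : ℝ≥0∞) ^ k)
    (fun e => .of_discrete), Real.exp_sum, ENNReal.ofReal_prod_of_nonneg fun _ _ => by positivity]
  refine Finset.prod_congr rfl fun e _ => ?_
  have h := lintegral_poissonMeasure_pow (M.arrival e).toNNReal (1 + x e)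
  push_cast at h
  rw [h, Real.coe_toNNReal _ (hM.arrival_pos e).le, add_sub_cancel_left]

lemma lintegral_eval_arrivalLaw (e : E) :
    ∫⁻ A, (A e : ℝ≥0∞) ∂M.arrivalLaw = (M.arrival e).toNNReal := by
  rw [arrivalLaw, lintegral_pi_eval (α := fun _ : E => ℕ) _ e
    (f := fun k => (k : ℝ≥0∞)) .of_discrete,
    lintegral_poissonMeasure_natCast]

lemma lintegral_eval_demandLaw (r : E → ℝ) (e : E) :
    ∫⁻ D, (D e : ℝ≥0∞) ∂(M.demandLaw r) = (M.demand e (r e)).toNNReal := by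
  rw [demandLaw, lintegral_pi_eval (α := fun _ : E => ℕ) _ e
    (f := fun k => (k : ℝ≥0∞)) .of_discrete,
    lintegral_poissonMeasure_natCast]

lemma lintegral_pow_eval_demandLaw (r : E → ℝ) (e : E) (w : ℝ≥0) :
    ∫⁻ D, (w : ℝ≥0∞) ^ D e ∂(M.demandLaw r)
      = ENNReal.ofReal (Real.exp ((M.demand e (r e)).toNNReal * (w - 1))) := by
  rw [demandLaw, lintegral_pi_eval (α := fun _ : E => ℕ) _ e
    (f := fun k => (w : ℝ≥0∞) ^ k) .of_discrete,
    lintegral_poissonMeasure_pow]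

lemma demandLaw_singleton_zero_pos (r : E → ℝ) : 0 < (M.demandLaw r).real {0} := by
  rw [measureReal_def, demandLaw, Measure.pi_singleton, ENNReal.toReal_prod]
  refine Finset.prod_pos fun e _ => ?_
  rw [Pi.zero_apply, poissonMeasure_singleton, ENNReal.toReal_ofReal (by positivity)]
  simp [Real.exp_pos]

/-! ### The transition law, its iterates, and the independence of the loads. -/

lemma IsRegular.lintegral_stepLaw (hM : M.IsRegular) (r p : E → ℝ) (σ : FreightState E)
    (f : FreightState E → ℝ≥0∞) :
    ∫⁻ τ, f τ ∂(M.stepLaw r p σ) = ∫⁻ X, ∫⁻ Z, ∫⁻ A, ∫⁻ D, f (Z + A, D) ∂(M.demandLaw r)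
      ∂M.arrivalLaw ∂(M.returnLaw (shipped X σ.2)) ∂(M.bookingLaw p σ.1) := by
  have := hM.isProbabilityMeasure_returnLaw
  rw [stepLaw, Measure.lintegral_bind Measurable.of_discrete.aemeasurable
    Measurable.of_discrete.aemeasurable]
  refine lintegral_congr fun X => ?_
  rw [lintegral_prod _ Measurable.of_discrete.aemeasurable,
    lintegral_map .of_discrete .of_discrete, lintegral_prod _ Measurable.of_discrete.aemeasurable]

lemma IsRegular.isProbabilityMeasure_stepLaw (hM : M.IsRegular) (r p : E → ℝ)
    (σ : FreightState E) : IsProbabilityMeasure (M.stepLaw r p σ) := by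
  have := hM.isProbabilityMeasure_returnLaw
  have := hM.isProbabilityMeasure_bookingLaw
  refine ⟨?_⟩
  rw [← lintegral_one, hM.lintegral_stepLaw]
  simp

lemma IsRegular.isProbabilityMeasure_stateLaw (hM : M.IsRegular) (r p : E → ℝ)
    (σ : FreightState E) (t : ℕ) : IsProbabilityMeasure (M.stateLaw r p σ t) := by
  induction t with
  | zero => rw [stateLaw]; infer_instance
  | succ t ih =>
    have := hM.isProbabilityMeasure_stepLaw r p
    refine ⟨?_⟩
    rw [← lintegral_one, stateLaw, Measure.lintegral_bind Measurable.of_discrete.aemeasurable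
      Measurable.of_discrete.aemeasurable]
    simp

lemma lintegral_stateLaw_succ (r p : E → ℝ) (σ : FreightState E) (t : ℕ)
    (f : FreightState E → ℝ≥0∞) :
    ∫⁻ τ, f τ ∂(M.stateLaw r p σ (t + 1))
      = ∫⁻ τ, ∫⁻ υ, f υ ∂(M.stepLaw r p τ) ∂(M.stateLaw r p σ t) := by
  rw [stateLaw, Measure.lintegral_bind Measurable.of_discrete.aemeasurable
    Measurable.of_discrete.aemeasurable]

/-- Decomposition at the first step, whereas `stateLaw` is defined by appending a last one. It
presents expected profits at later times as averages over the initial state. -/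
lemma stateLaw_succ' (r p : E → ℝ) (σ : FreightState E) (t : ℕ) :
    M.stateLaw r p σ (t + 1) = (M.stepLaw r p σ).bind fun τ => M.stateLaw r p τ t := by
  induction t with
  | zero =>
    simp only [stateLaw]
    rw [Measure.dirac_bind .of_discrete]
    exact Measure.bind_dirac.symm
  | succ t ih =>
    rw [stateLaw, ih, Measure.bind_bind Measurable.of_discrete.aemeasurable
      Measurable.of_discrete.aemeasurable]
    rfl

/-- The loads of a period are independent of everything before, and of the carriers. -/
lemma IsRegular.lintegral_mul_stepLaw (hM : M.IsRegular) (r p : E → ℝ) (σ : FreightState E)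
    (f g : (E → ℕ) → ℝ≥0∞) :
    ∫⁻ τ, f τ.1 * g τ.2 ∂(M.stepLaw r p σ)
      = (∫⁻ τ, f τ.1 ∂(M.stepLaw r p σ)) * ∫⁻ D, g D ∂(M.demandLaw r) := by
  rw [hM.lintegral_stepLaw, hM.lintegral_stepLaw]
  simp_rw [lintegral_const_mul _ (Measurable.of_discrete (f := g)),
    lintegral_mul_const _ Measurable.of_discrete]
  simp

lemma IsRegular.lintegral_mul_stateLaw (hM : M.IsRegular) (r p : E → ℝ) (σ : FreightState E)
    (t : ℕ) (f g : (E → ℕ) → ℝ≥0∞) :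
    ∫⁻ τ, f τ.1 * g τ.2 ∂(M.stateLaw r p σ (t + 1))
      = (∫⁻ τ, f τ.1 ∂(M.stateLaw r p σ (t + 1))) * ∫⁻ D, g D ∂(M.demandLaw r) := by
  rw [lintegral_stateLaw_succ, lintegral_stateLaw_succ]
  simp_rw [hM.lintegral_mul_stepLaw]
  rw [lintegral_mul_const _ Measurable.of_discrete]

lemma IsRegular.lintegral_loads_stepLaw (hM : M.IsRegular) (r p : E → ℝ) (σ : FreightState E)
    (g : (E → ℕ) → ℝ≥0∞) :
    ∫⁻ τ, g τ.2 ∂(M.stepLaw r p σ) = ∫⁻ D, g D ∂(M.demandLaw r) := by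
  have := hM.isProbabilityMeasure_stepLaw r p σ
  simpa using hM.lintegral_mul_stepLaw r p σ 1 g

lemma IsRegular.lintegral_loads_stateLaw (hM : M.IsRegular) (r p : E → ℝ) (σ : FreightState E)
    (t : ℕ) (g : (E → ℕ) → ℝ≥0∞) :
    ∫⁻ τ, g τ.2 ∂(M.stateLaw r p σ (t + 1)) = ∫⁻ D, g D ∂(M.demandLaw r) := by
  have := hM.isProbabilityMeasure_stateLaw r p σ (t + 1)
  simpa using hM.lintegral_mul_stateLaw r p σ t 1 g

lemma IsRegular.map_snd_stepLaw (hM : M.IsRegular) (r p : E → ℝ) (σ : FreightState E) :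
    (M.stepLaw r p σ).map Prod.snd = M.demandLaw r := by
  ext s hs
  rw [← lintegral_indicator_one hs, lintegral_map .of_discrete .of_discrete,
    hM.lintegral_loads_stepLaw r p σ (s.indicator 1), lintegral_indicator_one hs]

lemma IsRegular.map_snd_stateLaw (hM : M.IsRegular) (r p : E → ℝ) (σ : FreightState E) (t : ℕ) :
    (M.stateLaw r p σ (t + 1)).map Prod.snd = M.demandLaw r := by
  ext s hs
  rw [← lintegral_indicator_one hs, lintegral_map .of_discrete .of_discrete,
    hM.lintegral_loads_stateLaw r p σ t (s.indicator 1), lintegral_indicator_one hs]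

/-- If there are no loads, the next state does not depend on the carriers. -/
lemma IsRegular.stepLaw_no_loads (hM : M.IsRegular) (r p : E → ℝ) (S : E → ℕ) :
    M.stepLaw r p (S, 0) = M.stepLaw r p (0, 0) := by
  have := hM.isProbabilityMeasure_bookingLaw p
  have h (X : E → ℕ) : shipped X (0 : E → ℕ) = 0 := by ext e; simp [shipped]
  ext s hs
  rw [← lintegral_indicator_one hs, ← lintegral_indicator_one hs, hM.lintegral_stepLaw,
    hM.lintegral_stepLaw]
  simp [h]

/-! ### The expected profit of a period. -/

/-- The expected number of loads transported on a lane. -/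
noncomputable def meanShipped (M : FreightMarket E) (p : E → ℝ) (e : E) (σ : FreightState E) :
    ℝ≥0∞ :=
  ∫⁻ X, (shipped X σ.2 e : ℝ≥0∞) ∂(M.bookingLaw p σ.1)

lemma IsRegular.meanShipped_le_loads (hM : M.IsRegular) (p : E → ℝ) (e : E)
    (σ : FreightState E) : M.meanShipped p e σ ≤ σ.2 e := by
  have := hM.isProbabilityMeasure_bookingLaw p σ.1
  calc M.meanShipped p e σ ≤ ∫⁻ _, (σ.2 e : ℝ≥0∞) ∂(M.bookingLaw p σ.1) :=
        lintegral_mono fun X => Nat.cast_le.2 (min_le_right (X e) (σ.2 e))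
    _ = _ := by simp

lemma IsRegular.meanShipped_ne_top (hM : M.IsRegular) (p : E → ℝ) (e : E)
    (σ : FreightState E) : M.meanShipped p e σ ≠ ∞ :=
  ne_top_of_le_ne_top (by simp) (hM.meanShipped_le_loads p e σ)

lemma IsRegular.meanShipped_le_accept (hM : M.IsRegular) (p : E → ℝ) (e : E)
    (σ : FreightState E) : M.meanShipped p e σ ≤ M.acceptProb p e * σ.1 e := by
  rw [← hM.lintegral_eval_bookingLaw]
  exact lintegral_mono fun X => Nat.cast_le.2 (min_le_left (X e) (σ.2 e))

lemma IsRegular.expectedProfit_eq (hM : M.IsRegular) (r p : E → ℝ) (σ : FreightState E) :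
    M.expectedProfit r p σ = ∑ e, (r e * M.demand e (r e) - M.penalty e * σ.2 e
      + (M.penalty e - p e) * (M.meanShipped p e σ).toReal) := by
  have := hM.isProbabilityMeasure_bookingLaw p σ.1
  have hint (e : E) : Integrable (fun X => (shipped X σ.2 e : ℝ)) (M.bookingLaw p σ.1) := by
    refine Integrable.of_bound (C := σ.2 e) Measurable.of_discrete.aestronglyMeasurable
      (ae_of_all _ fun X => ?_)
    rw [Real.norm_natCast]
    exact Nat.cast_le.2 (min_le_right (X e) (σ.2 e))
  have hval (e : E) : ∫ X, (shipped X σ.2 e : ℝ) ∂(M.bookingLaw p σ.1)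
      = (M.meanShipped p e σ).toReal := by
    rw [integral_eq_lintegral_of_nonneg_ae (ae_of_all _ fun X => by positivity)
      Measurable.of_discrete.aestronglyMeasurable]
    simp [meanShipped]
  have h (X : E → ℕ) (e : E) : r e * M.demand e (r e)
      - M.penalty e * ((σ.2 e : ℝ) - (shipped X σ.2 e : ℝ)) - p e * (shipped X σ.2 e : ℝ)
      = r e * M.demand e (r e) - M.penalty e * σ.2 e
        + (M.penalty e - p e) * (shipped X σ.2 e : ℝ) := by ring
  simp_rw [expectedProfit, h]
  rw [integral_finsetSum Finset.univ (f := fun e X => r e * M.demand e (r e)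
    - M.penalty e * σ.2 e + (M.penalty e - p e) * (shipped X σ.2 e : ℝ))
    fun e _ => (integrable_const _).add ((hint e).const_mul _)]
  refine Finset.sum_congr rfl fun e _ => ?_
  rw [integral_add (integrable_const _) ((hint e).const_mul _), integral_const_mul, hval]
  simp

/-- A bound of the one-period profit in terms of the loads. -/
noncomputable def profitBound (M : FreightMarket E) (r p : E → ℝ) (D : E → ℕ) : ℝ :=
  ∑ e, (|r e * M.demand e (r e)| + (|M.penalty e| + |M.penalty e - p e|) * D e)

lemma IsRegular.abs_expectedProfit_le (hM : M.IsRegular) (r p : E → ℝ) (σ : FreightState E) :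
    |M.expectedProfit r p σ| ≤ M.profitBound r p σ.2 := by
  rw [hM.expectedProfit_eq]
  refine (Finset.abs_sum_le_sum_abs _ _).trans (Finset.sum_le_sum fun e _ => ?_)
  have h1 : (M.meanShipped p e σ).toReal ≤ σ.2 e := by
    simpa using ENNReal.toReal_mono (by simp) (hM.meanShipped_le_loads p e σ)
  refine (abs_add_le _ _).trans ?_
  have h2 := abs_sub (r e * M.demand e (r e)) (M.penalty e * σ.2 e)
  rw [abs_mul (M.penalty e), Nat.abs_cast] at h2
  rw [abs_mul (M.penalty e - p e), abs_of_nonneg ENNReal.toReal_nonneg]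
  nlinarith [mul_le_mul_of_nonneg_left h1 (abs_nonneg (M.penalty e - p e))]

lemma integrable_eval_demandLaw (r : E → ℝ) (e : E) :
    Integrable (fun D => (D e : ℝ)) (M.demandLaw r) := by
  refine ⟨Measurable.of_discrete.aestronglyMeasurable, ?_⟩
  rw [hasFiniteIntegral_iff_ofReal (ae_of_all _ fun D => by positivity)]
  simp [lintegral_eval_demandLaw]

lemma integrable_profitBound (r p : E → ℝ) : Integrable (M.profitBound r p) (M.demandLaw r) :=
  integrable_finsetSum _ fun e _ =>
    (integrable_const _).add ((integrable_eval_demandLaw r e).const_mul _)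

lemma IsRegular.integrable_of_loads (hM : M.IsRegular) (r p : E → ℝ) (σ : FreightState E) (t : ℕ)
    {g : (E → ℕ) → ℝ} (hg : Integrable g (M.demandLaw r)) :
    Integrable (fun τ => g τ.2) (M.stateLaw r p σ t) := by
  cases t with
  | zero => exact integrable_dirac (by simp)
  | succ t =>
    rw [← hM.map_snd_stateLaw r p σ t] at hg
    exact hg.comp_measurable .of_discrete

lemma IsRegular.integral_loads_stateLaw (hM : M.IsRegular) (r p : E → ℝ) (σ : FreightState E)
    (t : ℕ) (g : (E → ℕ) → ℝ) :
    ∫ τ, g τ.2 ∂(M.stateLaw r p σ (t + 1)) = ∫ D, g D ∂(M.demandLaw r) := by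
  rw [← hM.map_snd_stateLaw r p σ t, integral_map Measurable.of_discrete.aemeasurable
    Measurable.of_discrete.aestronglyMeasurable]

lemma IsRegular.integrable_expectedProfit (hM : M.IsRegular) (r p : E → ℝ) (σ : FreightState E)
    (t : ℕ) : Integrable (M.expectedProfit r p) (M.stateLaw r p σ t) :=
  (hM.integrable_of_loads r p σ t (integrable_profitBound r p)).mono'
    Measurable.of_discrete.aestronglyMeasurable
    (ae_of_all _ fun τ => hM.abs_expectedProfit_le r p τ)

lemma IsRegular.integral_expectedProfit_succ (hM : M.IsRegular) (r p : E → ℝ)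
    (σ : FreightState E) (t : ℕ) :
    ∫ τ, M.expectedProfit r p τ ∂(M.stateLaw r p σ (t + 1))
      = ∫ τ, ∫ υ, M.expectedProfit r p υ ∂(M.stateLaw r p τ t) ∂(M.stepLaw r p σ) := by
  have h := hM.integrable_expectedProfit r p σ (t + 1)
  rw [stateLaw_succ'] at h ⊢
  exact integral_bind_of_integrable .of_discrete h

lemma IsRegular.abs_integral_expectedProfit_le (hM : M.IsRegular) (r p : E → ℝ)
    (σ : FreightState E) (t : ℕ) :
    |∫ τ, M.expectedProfit r p τ ∂(M.stateLaw r p σ (t + 1))|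
      ≤ ∫ D, M.profitBound r p D ∂(M.demandLaw r) := by
  rw [← hM.integral_loads_stateLaw r p σ t]
  exact (abs_integral_le_integral_abs).trans (integral_mono
    (hM.integrable_expectedProfit r p σ (t + 1)).abs
    (hM.integrable_of_loads r p σ (t + 1) (integrable_profitBound r p))
    fun τ => hM.abs_expectedProfit_le r p τ)

/-! ### Ergodicity by a Doeblin contraction. -/

lemma IsRegular.integral_stepLaw_mem_Icc (hM : M.IsRegular) (r p : E → ℝ)
    {g : FreightState E → ℝ} {a b : ℝ} (hg : ∀ σ, g σ ∈ Set.Icc a b) (σ : FreightState E) :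
    ∫ τ, g τ ∂(M.stepLaw r p σ) ∈ Set.Icc a b := by
  have := hM.isProbabilityMeasure_stepLaw r p σ
  have hi : Integrable g (M.stepLaw r p σ) :=
    Integrable.of_mem_Icc a b Measurable.of_discrete.aemeasurable (ae_of_all _ hg)
  constructor
  · simpa using integral_mono (integrable_const a) hi fun τ => (hg τ).1
  · simpa using integral_mono hi (integrable_const b) fun τ => (hg τ).2

/-- Two steps of the chain contract the range of a bounded function: with a fixed positive
probability there are no loads after the first step, and the chain then forgets its past. -/
lemma IsRegular.le_integral_stepLaw_stepLaw (hM : M.IsRegular) (r p : E → ℝ)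
    {g : FreightState E → ℝ} {a b : ℝ} (hg : ∀ σ, g σ ∈ Set.Icc a b) (σ : FreightState E) :
    a + (M.demandLaw r).real {0} * (∫ υ, g υ ∂(M.stepLaw r p 0) - a)
      ≤ ∫ τ, ∫ υ, g υ ∂(M.stepLaw r p τ) ∂(M.stepLaw r p σ) := by
  have := hM.isProbabilityMeasure_stepLaw r p σ
  have hPg := hM.integral_stepLaw_mem_Icc r p hg
  have hi : Integrable (fun τ => ∫ υ, g υ ∂(M.stepLaw r p τ)) (M.stepLaw r p σ) :=
    Integrable.of_mem_Icc a b Measurable.of_discrete.aemeasurable (ae_of_all _ hPg)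
  set c := ∫ υ, g υ ∂(M.stepLaw r p 0) - a with hc
  have hs : MeasurableSet (Prod.snd ⁻¹' {0} : Set (FreightState E)) := .of_discrete
  have hk : Integrable ((Prod.snd ⁻¹' {0} : Set (FreightState E)).indicator fun _ => c)
      (M.stepLaw r p σ) := (integrable_const c).indicator hs
  have hreal : (M.stepLaw r p σ).real (Prod.snd ⁻¹' {0}) = (M.demandLaw r).real {0} := by
    rw [← hM.map_snd_stepLaw r p σ, map_measureReal_apply .of_discrete .of_discrete]
  -- The inner integral is at least `a` everywhere; when `τ` has no loads it equals the inner
  -- integral at the empty state, that is `a + c`.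
  calc a + (M.demandLaw r).real {0} * c
      = ∫ τ, (a + (Prod.snd ⁻¹' {0} : Set (FreightState E)).indicator (fun _ => c) τ)
          ∂(M.stepLaw r p σ) := by
        rw [integral_add (integrable_const a) hk, integral_indicator_const _ hs, hreal]
        simp
    _ ≤ _ := by
        refine integral_mono ((integrable_const a).add hk) hi fun τ => ?_
        by_cases h : τ.2 = 0
        · obtain ⟨S, D⟩ := τ
          obtain rfl : D = 0 := h
          simp only [Set.mem_preimage, Set.mem_singleton_iff, Set.indicator_of_mem, hc]
          rw [hM.stepLaw_no_loads r p S, add_sub_cancel]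
          rfl
        · simpa [h] using (hPg τ).1

/-- The profit is unbounded over initial states, but after one step the loads follow `demandLaw`,
which gives the first uniform interval. Each further pair of steps shrinks it by the factor `1 - ε`,
hence the times `2 * k + 1`. -/
lemma IsRegular.exists_Icc_expectedProfit (hM : M.IsRegular) (r p : E → ℝ) (k : ℕ) :
    ∃ a b : ℝ, b - a = (1 - (M.demandLaw r).real {0}) ^ k
        * (2 * ∫ D, M.profitBound r p D ∂(M.demandLaw r)) ∧
      ∀ σ, ∫ τ, M.expectedProfit r p τ ∂(M.stateLaw r p σ (2 * k + 1)) ∈ Set.Icc a b := by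
  induction k with
  | zero =>
    refine ⟨-∫ D, M.profitBound r p D ∂(M.demandLaw r),
      ∫ D, M.profitBound r p D ∂(M.demandLaw r), by ring, fun σ => ?_⟩
    exact abs_le.1 (hM.abs_integral_expectedProfit_le r p σ 0)
  | succ k ih =>
    obtain ⟨a, b, hab, h⟩ := ih
    set g := fun σ => ∫ τ, M.expectedProfit r p τ ∂(M.stateLaw r p σ (2 * k + 1)) with hg
    set ε := (M.demandLaw r).real {0}
    set m := ∫ υ, g υ ∂(M.stepLaw r p 0) with hm
    -- Both ends move toward the same value `m` by the fraction `ε`.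
    refine ⟨a + ε * (m - a), b - ε * (b - m), ?_, fun σ => ?_⟩
    · rw [pow_succ, mul_right_comm, ← hab]; ring
    · have h2 : ∫ τ, M.expectedProfit r p τ ∂(M.stateLaw r p σ (2 * (k + 1) + 1))
          = ∫ τ, ∫ υ, g υ ∂(M.stepLaw r p τ) ∂(M.stepLaw r p σ) := by
        rw [show 2 * (k + 1) + 1 = 2 * k + 1 + 1 + 1 by ring, hM.integral_expectedProfit_succ]
        simp_rw [hM.integral_expectedProfit_succ r p _ (2 * k + 1)]
        rfl
      rw [h2]
      refine ⟨hM.le_integral_stepLaw_stepLaw r p h σ, ?_⟩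
      -- The upper bound is the lower bound for `-g`.
      have h3 := hM.le_integral_stepLaw_stepLaw r p (g := fun σ => -g σ) (a := -b) (b := -a)
        (fun σ => ⟨neg_le_neg (h σ).2, neg_le_neg (h σ).1⟩) σ
      simp_rw [integral_neg] at h3
      change -b + ε * (-m - -b) ≤ _ at h3
      linarith

lemma IsRegular.integral_expectedProfit_mem_Icc_of_le (hM : M.IsRegular) (r p : E → ℝ) {a b : ℝ}
    {s t : ℕ} (hst : s ≤ t)
    (h : ∀ σ, ∫ τ, M.expectedProfit r p τ ∂(M.stateLaw r p σ s) ∈ Set.Icc a b)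
    (σ : FreightState E) :
    ∫ τ, M.expectedProfit r p τ ∂(M.stateLaw r p σ t) ∈ Set.Icc a b := by
  induction t, hst using Nat.le_induction generalizing σ with
  | base => exact h σ
  | succ t _ ih =>
    rw [hM.integral_expectedProfit_succ]
    exact hM.integral_stepLaw_mem_Icc r p ih σ

/-- The expected profit of a period converges, to the same limit from all initial states. -/
lemma IsRegular.exists_tendsto_expectedProfit (hM : M.IsRegular) (r p : E → ℝ) :
    ∃ γ : ℝ, ∀ σ, Tendsto
      (fun t => ∫ τ, M.expectedProfit r p τ ∂(M.stateLaw r p σ t)) atTop (𝓝 γ) := by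
  have hclose : ∀ δ > 0, ∃ N, ∀ s ≥ N, ∀ t ≥ N, ∀ σ υ,
      dist (∫ τ, M.expectedProfit r p τ ∂(M.stateLaw r p σ s))
        (∫ τ, M.expectedProfit r p τ ∂(M.stateLaw r p υ t)) < δ := by
    intro δ hδ
    have hlim : Tendsto (fun k : ℕ => (1 - (M.demandLaw r).real {0}) ^ k
        * (2 * ∫ D, M.profitBound r p D ∂(M.demandLaw r))) atTop (𝓝 0) := by
      have h := tendsto_pow_atTop_nhds_zero_of_lt_one
        (sub_nonneg.2 (measureReal_le_one (μ := M.demandLaw r) (s := {0})))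
        (sub_lt_self 1 (demandLaw_singleton_zero_pos (M := M) r))
      simpa using h.mul_const (2 * ∫ D, M.profitBound r p D ∂(M.demandLaw r))
    obtain ⟨k, hk⟩ := (hlim.eventually_lt_const hδ).exists
    obtain ⟨a, b, hab, h⟩ := hM.exists_Icc_expectedProfit r p k
    refine ⟨2 * k + 1, fun s hs t ht σ υ => ?_⟩
    have h1 := hM.integral_expectedProfit_mem_Icc_of_le r p hs h σ
    have h2 := hM.integral_expectedProfit_mem_Icc_of_le r p ht h υ
    exact (Real.dist_le_of_mem_Icc h1 h2).trans_lt (hab ▸ hk)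
  have hc : CauchySeq fun t => ∫ τ, M.expectedProfit r p τ ∂(M.stateLaw r p 0 t) :=
    Metric.cauchySeq_iff.2 fun δ hδ => (hclose δ hδ).imp fun N h s hs t ht => h s hs t ht 0 0
  obtain ⟨γ, hγ⟩ := cauchySeq_tendsto_of_complete hc
  refine ⟨γ, fun σ => ?_⟩
  refine hγ.congr_dist (Metric.tendsto_atTop.2 fun δ hδ => ?_)
  obtain ⟨N, h⟩ := hclose δ hδ
  exact ⟨N, fun t ht => by simpa using h t ht t ht 0 σ⟩

lemma IsRegular.isLongRunAverageProfit (hM : M.IsRegular) {r p : E → ℝ} {γ : ℝ}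
    (h : ∀ σ, Tendsto (fun t => ∫ τ, M.expectedProfit r p τ ∂(M.stateLaw r p σ t)) atTop (𝓝 γ)) :
    M.IsLongRunAverageProfit r p γ :=
  fun σ => ⟨hM.integrable_expectedProfit r p σ, (h σ).cesaro.congr fun T => by
    rw [div_eq_inv_mul]⟩

/-! ### Fluid equilibria and Poisson domination of the carriers. -/

/-- Under the posted prices `(r, p)`, the flows `y` of loads and `lam` of carriers balance. -/
structure IsFluidEquilibrium (M : FreightMarket E) (r p : E → ℝ) (y lam : E → ℝ) : Prop where
  flow : ∀ e : E, (∑ k : E with k.1.2 = e.1.1, M.stay e * y k) + M.arrival e = lam e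
  accept_mul : ∀ e, M.acceptProb p e * lam e = y e
  y_nonneg : ∀ e, 0 ≤ y e
  y_le_demand : ∀ e, y e ≤ M.demand e (r e)

lemma IsFluidEquilibrium.lam_nonneg {r p y lam : E → ℝ}
    (h : M.IsFluidEquilibrium r p y lam) (hM : M.IsRegular) (e : E) : 0 ≤ lam e := by
  rw [← h.flow]
  exact add_nonneg (Finset.sum_nonneg fun k _ => mul_nonneg (hM.stay_nonneg e) (h.y_nonneg k))
    (hM.arrival_pos e).le

/-- The only loss is replacing `min X D` by `X`, which can only increase the integrand because all
bases are at least `1`. -/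
lemma IsRegular.lintegral_prod_pow_stepLaw_le (hM : M.IsRegular) (r p : E → ℝ)
    (σ : FreightState E) (x : E → ℝ≥0) :
    ∫⁻ τ, ∏ e, (1 + x e : ℝ≥0∞) ^ τ.1 e ∂(M.stepLaw r p σ)
      ≤ ENNReal.ofReal (Real.exp (∑ e, M.arrival e * x e)) *
        ∏ k : E, (1 + (M.acceptProb p k * ∑ e : E with e.1.1 = k.1.2, (M.stay e).toNNReal * x e
          : ℝ≥0) : ℝ≥0∞) ^ σ.1 k := by
  rw [hM.lintegral_stepLaw, ← hM.lintegral_prod_pow_bookingLaw,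
    ← lintegral_const_mul _ Measurable.of_discrete]
  refine lintegral_mono fun X => ?_
  simp only [lintegral_const, measure_univ, mul_one, Pi.add_apply, pow_add,
    Finset.prod_mul_distrib]
  simp_rw [lintegral_const_mul _ Measurable.of_discrete, hM.lintegral_prod_pow_arrivalLaw,
    lintegral_mul_const _ Measurable.of_discrete, hM.lintegral_prod_pow_returnLaw]
  rw [mul_comm]
  gcongr
  · exact le_self_add
  · exact min_le_left _ _

/-- The carriers are dominated, in terms of generating functions, by independent Poisson variables
with the fluid means. -/
lemma IsFluidEquilibrium.lintegral_prod_pow_stateLaw_le {r p y lam : E → ℝ}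
    (h : M.IsFluidEquilibrium r p y lam) (hM : M.IsRegular) (t : ℕ) (x : E → ℝ≥0) :
    ∫⁻ τ, ∏ e, (1 + x e : ℝ≥0∞) ^ τ.1 e ∂(M.stateLaw r p 0 t)
      ≤ ENNReal.ofReal (Real.exp (∑ e, lam e * x e)) := by
  induction t generalizing x with
  | zero =>
    rw [stateLaw, lintegral_dirac]
    simpa using Finset.sum_nonneg fun e _ => mul_nonneg (h.lam_nonneg hM e) (x e).2
  | succ t ih =>
    rw [lintegral_stateLaw_succ]
    refine (lintegral_mono fun τ => hM.lintegral_prod_pow_stepLaw_le r p τ x).trans ?_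
    rw [lintegral_const_mul _ Measurable.of_discrete]
    refine (mul_le_mul_right (ih _) _).trans_eq ?_
    rw [← ENNReal.ofReal_mul (Real.exp_pos _).le, ← Real.exp_add]
    congr 2
    -- The exponent left by the inductive hypothesis is turned into a double sum over lanes.
    -- Exchanging the sums then gives the flow balance of each lane.
    have h1 (k : E) : lam k * (M.acceptProb p k * ∑ e : E with e.1.1 = k.1.2,
        (M.stay e).toNNReal * x e : ℝ≥0)
        = ∑ e : E, if k.1.2 = e.1.1 then M.stay e * y k * x e else 0 := by
      push_cast
      rw [← mul_assoc, mul_comm (lam k), h.accept_mul, Finset.mul_sum, Finset.sum_filter]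
      refine Finset.sum_congr rfl fun e _ => ?_
      rw [Real.coe_toNNReal _ (hM.stay_nonneg e)]
      by_cases hk : k.1.2 = e.1.1
      · simp only [hk, if_true]; ring
      · simp [hk, Ne.symm hk]
    simp_rw [h1]
    rw [Finset.sum_comm, ← Finset.sum_add_distrib]
    refine Finset.sum_congr rfl fun e _ => ?_
    rw [← h.flow, add_mul, Finset.sum_mul, Finset.sum_filter, add_comm]

lemma IsFluidEquilibrium.lintegral_pow_stateLaw_le {r p y lam : E → ℝ}
    (h : M.IsFluidEquilibrium r p y lam) (hM : M.IsRegular) (t : ℕ) (e : E) (x : ℝ≥0) :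
    ∫⁻ τ, (1 + x : ℝ≥0∞) ^ τ.1 e ∂(M.stateLaw r p 0 t)
      ≤ ENNReal.ofReal (Real.exp (lam e * x)) := by
  have h1 := h.lintegral_prod_pow_stateLaw_le hM t (Pi.single e x)
  have h2 (S : E → ℕ) :
      ∏ i, (1 + (Pi.single e x : E → ℝ≥0) i : ℝ≥0∞) ^ S i = (1 + x : ℝ≥0∞) ^ S e := by
    rw [Finset.prod_eq_single e] <;> simp +contextual
  have h3 : ∑ i, lam i * ((Pi.single e x : E → ℝ≥0) i : ℝ) = lam e * x := by
    rw [Finset.sum_eq_single e] <;> simp +contextual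
  simpa only [h2, h3] using h1

lemma IsRegular.lintegral_carriers_stepLaw (hM : M.IsRegular) (r p : E → ℝ)
    (σ : FreightState E) (e : E) :
    ∫⁻ τ, (τ.1 e : ℝ≥0∞) ∂(M.stepLaw r p σ)
      = ∑ k : E with k.1.2 = e.1.1, (M.stay e).toNNReal * M.meanShipped p k σ
        + (M.arrival e).toNNReal := by
  have := hM.isProbabilityMeasure_returnLaw
  have := hM.isProbabilityMeasure_bookingLaw p σ.1
  rw [hM.lintegral_stepLaw]
  simp_rw [lintegral_const, measure_univ, mul_one, Pi.add_apply, Nat.cast_add,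
    lintegral_add_left (Measurable.of_discrete (f := fun _ : E → ℕ => (_ : ℝ≥0∞))),
    lintegral_const, measure_univ, mul_one, lintegral_eval_arrivalLaw,
    hM.lintegral_eval_returnLaw]
  rw [lintegral_finsetSum _ fun _ _ => .of_discrete]
  simp_rw [lintegral_const_mul _ Measurable.of_discrete]
  simp [meanShipped]

/-! ### The excess of bookings over loads. -/

/-- This is `u ≤ exp u` at `u = s (k - l)`; the truncated difference is zero in the other case. -/
lemma natCast_sub_le_exp {s : ℝ} (hs : 0 < s) (k l : ℕ) :
    ((k - l : ℕ) : ℝ) ≤ s⁻¹ * (Real.exp s ^ k * Real.exp (-s) ^ l) := by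
  rw [← Real.exp_nat_mul, ← Real.exp_nat_mul, ← Real.exp_add]
  rcases le_total k l with h | h
  · rw [Nat.sub_eq_zero_of_le h, Nat.cast_zero]; positivity
  · rw [Nat.cast_sub h, inv_mul_eq_div, le_div_iff₀ hs]
    have := Real.add_one_le_exp (k * s + l * -s)
    nlinarith

/-- The linear terms cancel. The quadratic remainder is what permits `s` of order `1/√d` in the
excess bound. -/
lemma exp_add_exp_neg_le {s : ℝ} (hs : |s| ≤ 1) :
    (Real.exp s - 1) + (Real.exp (-s) - 1) ≤ 2 * s ^ 2 := by
  have h1 := (abs_le.1 (Real.abs_exp_sub_one_sub_id_le hs)).2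
  have h2 := (abs_le.1 (Real.abs_exp_sub_one_sub_id_le (x := -s) (by rwa [abs_neg]))).2
  rw [neg_sq] at h2
  linarith

/-- Split `X = min X D + (X - D)⁺`, bound the second term exponentially, and integrate over the
bookings; thinning turns `x` into `α x`. -/
lemma IsRegular.accept_mul_le (hM : M.IsRegular) (p : E → ℝ) {s : ℝ} (hs : 0 < s) {x : ℝ≥0}
    (hx : 1 + (x : ℝ) = Real.exp s) (e : E) (σ : FreightState E) :
    (M.acceptProb p e : ℝ≥0∞) * σ.1 e ≤ M.meanShipped p e σ + ENNReal.ofReal s⁻¹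
      * ((1 + (M.acceptProb p e * x : ℝ≥0) : ℝ≥0∞) ^ σ.1 e
        * ((Real.exp (-s)).toNNReal : ℝ≥0∞) ^ σ.2 e) := by
  have h1 := hM.lintegral_prod_pow_bookingLaw p σ.1 (Pi.single e x)
  have h2 (x : ℝ≥0) (S : E → ℕ) :
      ∏ i, (1 + (Pi.single e x : E → ℝ≥0) i : ℝ≥0∞) ^ S i = (1 + x : ℝ≥0∞) ^ S e := by
    rw [Finset.prod_eq_single e] <;> simp +contextual
  have h3 (i : E) : M.acceptProb p i * (Pi.single e x : E → ℝ≥0) i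
      = (Pi.single e (M.acceptProb p e * x) : E → ℝ≥0) i := by
    by_cases h : i = e
    · subst h; simp
    · simp [h]
  simp_rw [h3, h2] at h1
  rw [← hM.lintegral_eval_bookingLaw, ← h1, ← lintegral_mul_const _ Measurable.of_discrete,
    ← lintegral_const_mul _ Measurable.of_discrete, meanShipped,
    ← lintegral_add_left Measurable.of_discrete]
  refine lintegral_mono fun X => ?_
  have h4 : X e = shipped X σ.2 e + (X e - σ.2 e) := by simp only [shipped]; omega
  have h5 : ((X e - σ.2 e : ℕ) : ℝ≥0∞) ≤ ENNReal.ofReal s⁻¹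
      * ((1 + x : ℝ≥0∞) ^ X e * ((Real.exp (-s)).toNNReal : ℝ≥0∞) ^ σ.2 e) := by
    have h6 : (1 + x : ℝ≥0∞) = ENNReal.ofReal (Real.exp s) := by
      rw [← hx, ENNReal.ofReal_add zero_le_one x.coe_nonneg]; simp
    rw [h6, ← ENNReal.ofReal_natCast]
    change _ ≤ ENNReal.ofReal s⁻¹ * (_ * ENNReal.ofReal (Real.exp (-s)) ^ _)
    rw [← ENNReal.ofReal_pow (Real.exp_pos _).le, ← ENNReal.ofReal_pow (Real.exp_pos _).le,
      ← ENNReal.ofReal_mul (by positivity), ← ENNReal.ofReal_mul (by positivity)]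
    exact ENNReal.ofReal_le_ofReal (natCast_sub_le_exp hs _ _)
  conv_lhs => rw [h4, Nat.cast_add]
  exact add_le_add le_rfl h5

/-- The carriers who want to book exceed the loads by little. -/
lemma IsFluidEquilibrium.accept_mul_lintegral_le {r p y lam : E → ℝ}
    (h : M.IsFluidEquilibrium r p y lam) (hM : M.IsRegular) {s : ℝ} (hs : 0 < s) (hs1 : s ≤ 1)
    (t : ℕ) (e : E) :
    M.acceptProb p e * ∫⁻ τ, (τ.1 e : ℝ≥0∞) ∂(M.stateLaw r p 0 (t + 1))
      ≤ ∫⁻ τ, M.meanShipped p e τ ∂(M.stateLaw r p 0 (t + 1))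
        + ENNReal.ofReal (s⁻¹ * Real.exp (M.demand e (r e) * (2 * s ^ 2))) := by
  have hexp : 1 ≤ Real.exp s := Real.one_le_exp hs.le
  set x : ℝ≥0 := (Real.exp s - 1).toNNReal with hxdef
  have hx' : (x : ℝ) = Real.exp s - 1 := Real.coe_toNNReal _ (by linarith)
  have hx : 1 + (x : ℝ) = Real.exp s := by rw [hx']; ring
  have hd : 0 ≤ M.demand e (r e) := (h.y_nonneg e).trans (h.y_le_demand e)
  rw [← lintegral_const_mul _ Measurable.of_discrete]
  refine (lintegral_mono fun τ => hM.accept_mul_le p hs hx e τ).trans ?_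
  rw [lintegral_add_left Measurable.of_discrete]
  refine add_le_add le_rfl ?_
  -- Carriers and loads factor. The period `t + 1` is needed for the loads to have their Poisson
  -- law.
  rw [lintegral_const_mul _ Measurable.of_discrete,
    hM.lintegral_mul_stateLaw r p 0 t (fun S => (1 + (M.acceptProb p e * x : ℝ≥0) : ℝ≥0∞) ^ S e)
      (fun D => ((Real.exp (-s)).toNNReal : ℝ≥0∞) ^ D e), lintegral_pow_eval_demandLaw,
    ENNReal.ofReal_mul (by positivity)]
  refine mul_le_mul_right ?_ _
  refine (mul_le_mul_left (h.lintegral_pow_stateLaw_le hM (t + 1) e _) _).trans ?_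
  rw [← ENNReal.ofReal_mul (Real.exp_pos _).le, ← Real.exp_add]
  refine ENNReal.ofReal_le_ofReal (Real.exp_le_exp.2 ?_)
  rw [Real.coe_toNNReal _ hd, Real.coe_toNNReal _ (Real.exp_pos _).le, NNReal.coe_mul,
    ← mul_assoc, mul_comm (lam e), h.accept_mul]
  -- Here `y ≤ d` enters: it lets the linear terms of the two exponents cancel.
  have h1 : y e * x ≤ M.demand e (r e) * (Real.exp s - 1) :=
    hx' ▸ mul_le_mul_of_nonneg_right (h.y_le_demand e) x.2
  have h2 := mul_le_mul_of_nonneg_left (exp_add_exp_neg_le (abs_le.2 ⟨by linarith, hs1⟩)) hd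
  linarith

/-! ### The recursion for mean shipments and the resulting profit gap. -/

lemma IsRegular.lintegral_carriers_stateLaw_succ (hM : M.IsRegular) (r p : E → ℝ)
    (σ : FreightState E) (t : ℕ) (e : E) :
    ∫⁻ τ, (τ.1 e : ℝ≥0∞) ∂(M.stateLaw r p σ (t + 1))
      = ∑ k : E with k.1.2 = e.1.1, (M.stay e).toNNReal
          * ∫⁻ τ, M.meanShipped p k τ ∂(M.stateLaw r p σ t) + (M.arrival e).toNNReal := by
  have := hM.isProbabilityMeasure_stateLaw r p σ t
  rw [lintegral_stateLaw_succ]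
  simp_rw [hM.lintegral_carriers_stepLaw]
  rw [lintegral_add_right _ measurable_const, lintegral_finsetSum _ fun _ _ => .of_discrete]
  simp_rw [lintegral_const_mul _ Measurable.of_discrete]
  simp

/-- The fluid flows are a fixed point of the mean recursion without lost bookings, and the empty
state starts below it. This makes the shortfalls nonnegative and the later profit estimate
two-sided. -/
lemma IsFluidEquilibrium.lintegral_carriers_le {r p y lam : E → ℝ}
    (h : M.IsFluidEquilibrium r p y lam) (hM : M.IsRegular) (t : ℕ) (e : E) :
    ∫⁻ τ, (τ.1 e : ℝ≥0∞) ∂(M.stateLaw r p 0 t) ≤ ENNReal.ofReal (lam e) ∧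
    ∫⁻ τ, M.meanShipped p e τ ∂(M.stateLaw r p 0 t) ≤ ENNReal.ofReal (y e) := by
  have hship (t : ℕ) (e : E)
      (h1 : ∫⁻ τ, (τ.1 e : ℝ≥0∞) ∂(M.stateLaw r p 0 t) ≤ ENNReal.ofReal (lam e)) :
      ∫⁻ τ, M.meanShipped p e τ ∂(M.stateLaw r p 0 t) ≤ ENNReal.ofReal (y e) := by
    refine (lintegral_mono fun τ => hM.meanShipped_le_accept p e τ).trans ?_
    rw [lintegral_const_mul _ Measurable.of_discrete]
    refine (mul_le_mul_right h1 _).trans_eq ?_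
    rw [← h.accept_mul, ENNReal.ofReal_mul (by positivity), ENNReal.ofReal_coe_nnreal]
  suffices ∀ e, ∫⁻ τ, (τ.1 e : ℝ≥0∞) ∂(M.stateLaw r p 0 t) ≤ ENNReal.ofReal (lam e) from
    ⟨this e, hship t e (this e)⟩
  induction t with
  | zero => intro e; rw [stateLaw, lintegral_dirac]; simp
  | succ t ih =>
    intro e
    rw [hM.lintegral_carriers_stateLaw_succ, ← h.flow, ENNReal.ofReal_add
      (Finset.sum_nonneg fun k _ => mul_nonneg (hM.stay_nonneg e) (h.y_nonneg k))
      (hM.arrival_pos e).le, ENNReal.ofReal_sum_of_nonneg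
      fun k _ => mul_nonneg (hM.stay_nonneg e) (h.y_nonneg k)]
    refine add_le_add (Finset.sum_le_sum fun k _ => ?_) le_rfl
    rw [ENNReal.ofReal_mul (hM.stay_nonneg e)]
    exact mul_le_mul_right (hship t k (ih k)) _

/-- The expected number of loads transported on lane `e` in period `t`, from the empty state. -/
noncomputable def shippedMean (M : FreightMarket E) (r p : E → ℝ) (t : ℕ) (e : E) : ℝ :=
  (∫⁻ τ, M.meanShipped p e τ ∂(M.stateLaw r p 0 t)).toReal

lemma IsFluidEquilibrium.shippedMean_le {r p y lam : E → ℝ}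
    (h : M.IsFluidEquilibrium r p y lam) (hM : M.IsRegular) (t : ℕ) (e : E) :
    M.shippedMean r p t e ≤ y e :=
  ENNReal.toReal_le_of_le_ofReal (h.y_nonneg e) (h.lintegral_carriers_le hM t e).2

lemma IsFluidEquilibrium.accept_mul_le_shippedMean {r p y lam : E → ℝ}
    (h : M.IsFluidEquilibrium r p y lam) (hM : M.IsRegular) {s : ℝ} (hs : 0 < s) (hs1 : s ≤ 1)
    (t : ℕ) (e : E) :
    M.acceptProb p e * (∑ k : E with k.1.2 = e.1.1, M.stay e * M.shippedMean r p t k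
        + M.arrival e)
      ≤ M.shippedMean r p (t + 1) e + s⁻¹ * Real.exp (M.demand e (r e) * (2 * s ^ 2)) := by
  have hfin (t : ℕ) (e : E) : ∫⁻ τ, M.meanShipped p e τ ∂(M.stateLaw r p 0 t) ≠ ∞ :=
    ne_top_of_le_ne_top ENNReal.ofReal_ne_top (h.lintegral_carriers_le hM t e).2
  have h1 := ENNReal.toReal_mono (ENNReal.add_ne_top.2 ⟨hfin _ _, ENNReal.ofReal_ne_top⟩)
    (h.accept_mul_lintegral_le hM hs hs1 t e)
  rw [hM.lintegral_carriers_stateLaw_succ, ENNReal.toReal_mul, ENNReal.toReal_add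
    (ENNReal.sum_ne_top.2 fun k _ => ENNReal.mul_ne_top ENNReal.coe_ne_top (hfin t k))
    ENNReal.coe_ne_top, ENNReal.toReal_sum
    (fun k _ => ENNReal.mul_ne_top ENNReal.coe_ne_top (hfin t k)),
    ENNReal.toReal_add (hfin _ _) ENNReal.ofReal_ne_top,
    ENNReal.toReal_ofReal (by positivity)] at h1
  simp_rw [ENNReal.toReal_mul, ENNReal.coe_toReal, Real.coe_toNNReal _ (hM.stay_nonneg e),
    Real.coe_toNNReal _ (hM.arrival_pos e).le] at h1
  exact h1

/-- If every shortfall is at most `c y`, endogenous supply falls by at most `c (lam - arrival) ≤ c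
(1 - η) lam`. After acceptance this costs at most `c (1 - η) y`, and the excess adds at most `η κ
y`; the bound `(1 - η) ^ t + κ` solves this recursion. -/
lemma IsFluidEquilibrium.sub_shippedMean_le {r p y lam : E → ℝ}
    (h : M.IsFluidEquilibrium r p y lam) (hM : M.IsRegular) {s η κ : ℝ} (hs : 0 < s) (hs1 : s ≤ 1)
    (hη1 : η ≤ 1) (hκ : 0 ≤ κ) (hη : ∀ e, η * lam e ≤ M.arrival e)
    (hsκ : ∀ e, 0 < y e →
      s⁻¹ * Real.exp (M.demand e (r e) * (2 * s ^ 2)) ≤ η * κ * y e) (t : ℕ) (e : E) :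
    y e - M.shippedMean r p t e ≤ ((1 - η) ^ t + κ) * y e := by
  induction t generalizing e with
  | zero =>
    have h1 : 0 ≤ M.shippedMean r p 0 e := ENNReal.toReal_nonneg
    nlinarith [mul_nonneg hκ (h.y_nonneg e)]
  | succ t ih =>
    -- On a lane with zero fluid flow the excess cannot be bounded relative to `y`, but there is no
    -- shortfall either.
    rcases (h.y_nonneg e).eq_or_lt with h0 | h0
    · rw [← h0]
      have : 0 ≤ M.shippedMean r p (t + 1) e := ENNReal.toReal_nonneg
      simpa using this
    set c := (1 - η) ^ t + κ
    have hc : 0 ≤ c := add_nonneg (pow_nonneg (by linarith) _) hκ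
    have hα : (0 : ℝ) ≤ M.acceptProb p e := NNReal.coe_nonneg _
    have h1 := h.accept_mul_le_shippedMean hM hs hs1 t e
    have h2 := hsκ e h0
    have h3 : (1 - c) * (lam e - M.arrival e)
        ≤ ∑ k : E with k.1.2 = e.1.1, M.stay e * M.shippedMean r p t k := by
      rw [← h.flow, add_sub_cancel_right, Finset.mul_sum]
      refine Finset.sum_le_sum fun k _ => ?_
      have := mul_le_mul_of_nonneg_left (ih k) (hM.stay_nonneg e)
      linarith
    have h4 := mul_le_mul_of_nonneg_left h3 hα
    have h5 := mul_le_mul_of_nonneg_left (hη e) (mul_nonneg hc hα)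
    have h6 := h.accept_mul e
    have h7 : c * M.acceptProb p e * (η * lam e) = c * η * y e := by rw [← h6]; ring
    have h8 : M.acceptProb p e * ((1 - c) * (lam e - M.arrival e))
      = (1 - c) * y e - M.acceptProb p e * M.arrival e
        + c * M.acceptProb p e * M.arrival e := by rw [← h6]; ring
    have h9 : ((1 - η) ^ (t + 1) + κ) * y e = c * (1 - η) * y e + η * κ * y e := by
      simp only [c]; ring
    rw [h9]
    nlinarith

/-- The expected profit of a period, from the empty state. -/
lemma IsFluidEquilibrium.integral_expectedProfit_eq {r p y lam : E → ℝ}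
    (h : M.IsFluidEquilibrium r p y lam) (hM : M.IsRegular) (t : ℕ) :
    ∫ τ, M.expectedProfit r p τ ∂(M.stateLaw r p 0 (t + 1))
      = ∑ e, (r e * M.demand e (r e) - M.penalty e * M.demand e (r e)
        + (M.penalty e - p e) * M.shippedMean r p (t + 1) e) := by
  have := hM.isProbabilityMeasure_stateLaw r p 0 (t + 1)
  have hD (e : E) := hM.integrable_of_loads r p 0 (t + 1) (integrable_eval_demandLaw r e)
  have hDv (e : E) : ∫ τ, (τ.2 e : ℝ) ∂(M.stateLaw r p 0 (t + 1)) = M.demand e (r e) := by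
    rw [hM.integral_loads_stateLaw r p 0 t (fun D => (D e : ℝ)),
      integral_eq_lintegral_of_nonneg_ae (ae_of_all _ fun D => by positivity)
      Measurable.of_discrete.aestronglyMeasurable]
    simp [lintegral_eval_demandLaw, (h.y_nonneg e).trans (h.y_le_demand e)]
  have hY (e : E) : Integrable (fun τ => (M.meanShipped p e τ).toReal)
      (M.stateLaw r p 0 (t + 1)) :=
    integrable_toReal_of_lintegral_ne_top Measurable.of_discrete.aemeasurable
      (ne_top_of_le_ne_top ENNReal.ofReal_ne_top (h.lintegral_carriers_le hM (t + 1) e).2)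
  have hYv (e : E) : ∫ τ, (M.meanShipped p e τ).toReal ∂(M.stateLaw r p 0 (t + 1))
      = M.shippedMean r p (t + 1) e :=
    integral_toReal Measurable.of_discrete.aemeasurable
      (ae_of_all _ fun τ => (hM.meanShipped_ne_top p e τ).lt_top)
  simp_rw [hM.expectedProfit_eq]
  rw [integral_finsetSum Finset.univ (f := fun e τ => r e * M.demand e (r e)
    - M.penalty e * τ.2 e + (M.penalty e - p e) * (M.meanShipped p e τ).toReal)
    fun e _ => ((integrable_const _).sub ((hD e).const_mul _)).add ((hY e).const_mul _)]
  refine Finset.sum_congr rfl fun e _ => ?_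
  rw [integral_add (f := fun τ => r e * M.demand e (r e) - M.penalty e * τ.2 e)
    ((integrable_const _).sub ((hD e).const_mul _)) ((hY e).const_mul _),
    integral_sub (integrable_const _) ((hD e).const_mul _),
    integral_const, integral_const_mul, integral_const_mul, hDv, hYv]
  simp

/-- The limit profit is close to the fluid profit. -/
lemma IsFluidEquilibrium.abs_sub_limit_le {r p y lam : E → ℝ}
    (h : M.IsFluidEquilibrium r p y lam) (hM : M.IsRegular) {s η κ γ : ℝ} (hs : 0 < s)
    (hs1 : s ≤ 1) (hη0 : 0 < η) (hη1 : η ≤ 1) (hκ : 0 ≤ κ) (hη : ∀ e, η * lam e ≤ M.arrival e)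
    (hsκ : ∀ e, 0 < y e → s⁻¹ * Real.exp (M.demand e (r e) * (2 * s ^ 2)) ≤ η * κ * y e)
    (hγ : Tendsto (fun t => ∫ τ, M.expectedProfit r p τ ∂(M.stateLaw r p 0 t)) atTop (𝓝 γ)) :
    |∑ e, (r e * M.demand e (r e) - p e * y e - M.penalty e * (M.demand e (r e) - y e)) - γ|
      ≤ κ * ∑ e, |M.penalty e - p e| * y e := by
  set V := ∑ e, (r e * M.demand e (r e) - p e * y e - M.penalty e * (M.demand e (r e) - y e))
  have hbound (t : ℕ) : |V - ∫ τ, M.expectedProfit r p τ ∂(M.stateLaw r p 0 (t + 1))|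
      ≤ ((1 - η) ^ (t + 1) + κ) * ∑ e, |M.penalty e - p e| * y e := by
    rw [h.integral_expectedProfit_eq hM, ← Finset.sum_sub_distrib, Finset.mul_sum]
    refine (Finset.abs_sum_le_sum_abs _ _).trans (Finset.sum_le_sum fun e _ => ?_)
    have h1 := h.sub_shippedMean_le hM hs hs1 hη1 hκ hη hsκ (t + 1) e
    have h2 : 0 ≤ y e - M.shippedMean r p (t + 1) e := sub_nonneg.2 (h.shippedMean_le hM _ e)
    have h3 := mul_le_mul_of_nonneg_left h1 (abs_nonneg (M.penalty e - p e))
    rw [← abs_of_nonneg h2, ← abs_mul] at h3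
    refine le_trans (le_of_eq ?_) (h3.trans_eq ?_)
    · congr 1; ring
    · ring
  have hl : Tendsto (fun t : ℕ => ((1 - η) ^ (t + 1) + κ) * ∑ e, |M.penalty e - p e| * y e)
      atTop (𝓝 ((0 + κ) * ∑ e, |M.penalty e - p e| * y e)) :=
    ((((tendsto_pow_atTop_nhds_zero_of_lt_one (sub_nonneg.2 hη1) (sub_lt_self 1 hη0)).comp
      (tendsto_add_atTop_nat 1)).add_const κ).mul_const _)
  rw [zero_add] at hl
  exact le_of_tendsto_of_tendsto ((hγ.comp (tendsto_add_atTop_nat 1)).const_sub V).abs hl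
    (Eventually.of_forall hbound)

/-! ### Homogeneity of the fluid problem. -/

lemma IsRegular.scale (hM : M.IsRegular) {θ : ℝ} (hθ : 0 < θ) : (M.scale θ).IsRegular where
  demand_nonneg e r hr := mul_nonneg hθ.le (hM.demand_nonneg e r hr)
  demand_strictAnti e _ hr _ hs h := mul_lt_mul_of_pos_left (hM.demand_strictAnti e hr hs h) hθ
  arrival_pos e := mul_pos hθ (hM.arrival_pos e)
  stay_nonneg := hM.stay_nonneg
  stay_sum_le_one := hM.stay_sum_le_one
  cost_prob := hM.cost_prob
  cost_nonneg := hM.cost_nonneg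
  cost_density := hM.cost_density
  cost_strictMono := hM.cost_strictMono

lemma invDemand_mem {e : E} {d : ℝ} (hd : d ∈ M.demand e '' M.priceSet e) :
    M.invDemand e d ∈ M.priceSet e :=
  Function.invFunOn_mem hd

lemma demand_invDemand {e : E} {d : ℝ} (hd : d ∈ M.demand e '' M.priceSet e) :
    M.demand e (M.invDemand e d) = d :=
  Function.invFunOn_eq hd

lemma mul_mem_scale_demand {θ : ℝ} (hθ : θ ≠ 0) {e : E} {d : ℝ} :
    θ * d ∈ (M.scale θ).demand e '' (M.scale θ).priceSet e ↔
      d ∈ M.demand e '' M.priceSet e := by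
  simp [scale, hθ]

/-- `invFunOn` picks some preimage; strict monotonicity of demand makes the two choices agree. -/
lemma IsRegular.invDemand_scale (hM : M.IsRegular) {θ : ℝ} (hθ : θ ≠ 0) {e : E} {d : ℝ}
    (hd : d ∈ M.demand e '' M.priceSet e) :
    (M.scale θ).invDemand e (θ * d) = M.invDemand e d := by
  have hd' := (mul_mem_scale_demand hθ).2 hd
  refine (hM.demand_strictAnti e).injOn (invDemand_mem (M := M.scale θ) hd') (invDemand_mem hd) ?_
  rw [demand_invDemand hd]
  exact mul_left_cancel₀ hθ (demand_invDemand (M := M.scale θ) hd')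

/-- A candidate of the fluid problem with all quantities multiplied by `θ`. -/
def mulPoint (θ : ℝ) (z : FluidPoint E) : FluidPoint E where
  d e := θ * z.d e
  y e := θ * z.y e
  lam e := θ * z.lam e

lemma fluidFeasible_scale_iff {θ : ℝ} (hθ : 0 < θ) {z : FluidPoint E} :
    (M.scale θ).FluidFeasible (mulPoint θ z) ↔ M.FluidFeasible z := by
  have hflow (e : E) : (∑ k : E with k.1.2 = e.1.1, M.stay e * (θ * z.y k)) + θ * M.arrival e
      = θ * z.lam e ↔ (∑ k : E with k.1.2 = e.1.1, M.stay e * z.y k) + M.arrival e = z.lam e := by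
    simp_rw [mul_left_comm _ θ]
    rw [← Finset.mul_sum, ← mul_add, mul_right_inj' hθ.ne']
  have hratio (e : E) : θ * z.y e / (θ * z.lam e) = z.y e / z.lam e :=
    mul_div_mul_left _ _ hθ.ne'
  constructor
  · rintro ⟨h1, h2, h3, h4, h5, h6, h7, h8⟩
    exact ⟨fun e => (hflow e).1 (h1 e), fun e => le_of_mul_le_mul_left (h2 e) hθ,
      fun e => le_of_mul_le_mul_left (h3 e) hθ, fun e => nonneg_of_mul_nonneg_right (h4 e) hθ,
      fun e => nonneg_of_mul_nonneg_right (h5 e) hθ, fun e => nonneg_of_mul_nonneg_right (h6 e) hθ,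
      fun e => (mul_mem_scale_demand hθ.ne').1 (h7 e), fun e => hratio e ▸ h8 e⟩
  · rintro ⟨h1, h2, h3, h4, h5, h6, h7, h8⟩
    exact ⟨fun e => (hflow e).2 (h1 e), fun e => mul_le_mul_of_nonneg_left (h2 e) hθ.le,
      fun e => mul_le_mul_of_nonneg_left (h3 e) hθ.le, fun e => mul_nonneg hθ.le (h4 e),
      fun e => mul_nonneg hθ.le (h5 e), fun e => mul_nonneg hθ.le (h6 e),
      fun e => (mul_mem_scale_demand hθ.ne').2 (h7 e), fun e => (hratio e).symm ▸ h8 e⟩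

lemma IsRegular.fluidObjective_scale (hM : M.IsRegular) {θ : ℝ} (hθ : 0 < θ) {z : FluidPoint E}
    (hz : M.FluidFeasible z) :
    (M.scale θ).fluidObjective (mulPoint θ z) = θ * M.fluidObjective z := by
  rw [fluidObjective, fluidObjective, Finset.mul_sum]
  refine Finset.sum_congr rfl fun e _ => ?_
  simp only [mulPoint]
  rw [hM.invDemand_scale hθ.ne' (hz.d_mem e), mul_div_mul_left _ _ hθ.ne']
  change _ - M.costQuantile e _ * _ - M.penalty e * _ = _
  ring

lemma IsFluidOptimal.fluidValue_eq {z : FluidPoint E} (hz : M.IsFluidOptimal z) :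
    M.fluidValue = M.fluidObjective z :=
  IsGreatest.csSup_eq ⟨Set.mem_image_of_mem _ hz.1, Set.forall_mem_image.2 hz.2⟩

lemma IsFluidOptimal.scale {z : FluidPoint E} (hz : M.IsFluidOptimal z) (hM : M.IsRegular)
    {θ : ℝ} (hθ : 0 < θ) : (M.scale θ).IsFluidOptimal (mulPoint θ z) := by
  refine ⟨(fluidFeasible_scale_iff hθ).2 hz.1, fun w hw => ?_⟩
  -- Scaling by `θ⁻¹` shows that every competitor comes from the unscaled problem.
  obtain ⟨v, rfl⟩ : ∃ v, w = mulPoint θ v :=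
    ⟨mulPoint θ⁻¹ w, by simp [mulPoint, mul_inv_cancel_left₀ hθ.ne']⟩
  have hv := (fluidFeasible_scale_iff hθ).1 hw
  rw [hM.fluidObjective_scale hθ hv, hM.fluidObjective_scale hθ hz.1]
  exact mul_le_mul_of_nonneg_left (hz.2 v hv) hθ.le

lemma IsFluidOptimal.fluidValue_scale {z : FluidPoint E} (hz : M.IsFluidOptimal z)
    (hM : M.IsRegular) {θ : ℝ} (hθ : 0 < θ) :
    (M.scale θ).fluidValue = θ * M.fluidObjective z := by
  rw [(hz.scale hM hθ).fluidValue_eq, hM.fluidObjective_scale hθ hz.1]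

/-! ### From a feasible fluid point to an equilibrium at its prices. -/

lemma IsRegular.costCDF_zero (hM : M.IsRegular) (e : E) : M.costCDF e 0 = 0 := by
  have := hM.cost_prob e
  rw [costCDF, cdf_eq_real, measureReal_def, ENNReal.toReal_eq_zero_iff]
  left
  rw [← Set.Iio_union_right, measure_union_null_iff]
  exact ⟨hM.cost_nonneg e, hM.cost_density e (by simp)⟩

/-- One inequality is monotonicity at a point where `x` is attained; the other is right-continuity
at the infimum. -/
lemma IsRegular.costCDF_costQuantile (hM : M.IsRegular) {e : E} {x : ℝ}
    (hx : x ∈ Set.range (M.costCDF e)) : M.costCDF e (M.costQuantile e x) = x := by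
  have hmono : Monotone (M.costCDF e) := monotone_cdf _
  obtain ⟨c, hc0, hc⟩ : ∃ c, 0 ≤ c ∧ M.costCDF e c = x := by
    obtain ⟨c, rfl⟩ := hx
    rcases le_total 0 c with h | h
    · exact ⟨c, h, rfl⟩
    -- A value attained at a negative cost is `0`, hence also attained at cost `0`.
    · exact ⟨0, le_rfl, le_antisymm ((hM.costCDF_zero e).trans_le (cdf_nonneg _ _)) (hmono h)⟩
  have hmem : c ∈ {c : ℝ | 0 ≤ c ∧ x ≤ M.costCDF e c} := ⟨hc0, hc.ge⟩
  refine le_antisymm (hc ▸ hmono (csInf_le ⟨0, fun _ h => h.1⟩ (hc.symm ▸ hmem))) ?_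
  have hcont : Tendsto (M.costCDF e) (𝓝[>] M.costQuantile e x)
      (𝓝 (M.costCDF e (M.costQuantile e x))) :=
    ((cdf (M.costLaw e)).right_continuous _).tendsto.mono_left
      (nhdsWithin_mono _ Set.Ioi_subset_Ici_self)
  refine ge_of_tendsto hcont (eventually_nhdsWithin_of_forall fun a ha => ?_)
  obtain ⟨b, hb, hba⟩ := exists_lt_of_csInf_lt ⟨c, hmem⟩ ha
  exact hb.2.trans (hmono hba.le)

lemma IsRegular.acceptProb_carrierPrice (hM : M.IsRegular) {z : FluidPoint E}
    (hz : M.FluidFeasible z) (e : E) :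
    (M.acceptProb (M.carrierPrice z) e : ℝ) = z.y e / z.lam e := by
  have := hM.cost_prob e
  rw [← hM.costCDF_costQuantile (hz.ratio_mem e), costCDF, cdf_eq_real]
  rfl

lemma FluidFeasible.lam_pos {z : FluidPoint E} (hz : M.FluidFeasible z) (hM : M.IsRegular)
    (e : E) : 0 < z.lam e := by
  rw [← hz.flow]
  exact add_pos_of_nonneg_of_pos
    (Finset.sum_nonneg fun k _ => mul_nonneg (hM.stay_nonneg e) (hz.y_nonneg k)) (hM.arrival_pos e)

lemma demand_shipperPrice {z : FluidPoint E} (hz : M.FluidFeasible z) (e : E) :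
    M.demand e (M.shipperPrice z e) = z.d e :=
  demand_invDemand (hz.d_mem e)

lemma IsRegular.isFluidEquilibrium_scale (hM : M.IsRegular) {z : FluidPoint E}
    (hz : M.FluidFeasible z) {θ : ℝ} (hθ : 0 < θ) :
    (M.scale θ).IsFluidEquilibrium (M.shipperPrice z) (M.carrierPrice z)
      (fun e => θ * z.y e) (fun e => θ * z.lam e) where
  flow := ((fluidFeasible_scale_iff hθ).2 hz).flow
  accept_mul e := by
    change (M.acceptProb (M.carrierPrice z) e : ℝ) * _ = _
    rw [hM.acceptProb_carrierPrice hz, mul_left_comm, div_mul_cancel₀ _ (hz.lam_pos hM e).ne']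
  y_nonneg e := mul_nonneg hθ.le (hz.y_nonneg e)
  y_le_demand e := by
    change _ ≤ θ * M.demand e (M.shipperPrice z e)
    rw [demand_shipperPrice hz]
    exact mul_le_mul_of_nonneg_left (hz.y_le_d e) hθ.le

/-! ### Choice of constants and the square-root bound. -/

lemma exists_pos_le_one_mul_le {ι : Type*} [Finite ι] {a b : ι → ℝ} (hb : ∀ i, 0 < b i) :
    ∃ η : ℝ, 0 < η ∧ η ≤ 1 ∧ ∀ i, η * a i ≤ b i := by
  have h (i : ι) : ∀ᶠ η : ℝ in 𝓝[>] 0, η * a i ≤ b i := by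
    have : Tendsto (fun η : ℝ => η * a i) (𝓝[>] 0) (𝓝 (0 * a i)) :=
      (tendsto_id.mul_const (a i)).mono_left nhdsWithin_le_nhds
    rw [zero_mul] at this
    exact (this.eventually_lt_const (hb i)).mono fun _ => le_of_lt
  have h1 : ∀ᶠ η : ℝ in 𝓝[>] 0, η ∈ Set.Ioo (0 : ℝ) 1 := Ioo_mem_nhdsGT one_pos
  obtain ⟨η, hη, hη1⟩ := ((eventually_all.2 h).and h1).exists
  exact ⟨η, hη1.1, hη1.2.le, hη⟩

lemma exists_nonneg_le_mul {ι : Type*} [Finite ι] (a b : ι → ℝ) :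
    ∃ K : ℝ, 0 ≤ K ∧ ∀ i, 0 < b i → a i ≤ K * b i := by
  have h (i : ι) : ∀ᶠ K : ℝ in atTop, 0 < b i → a i ≤ K * b i := by
    by_cases hb : 0 < b i
    · exact ((tendsto_id.atTop_mul_const hb).eventually_ge_atTop (a i)).mono fun _ h _ => h
    · exact Eventually.of_forall fun _ h => absurd h hb
  obtain ⟨K, hK, hK0⟩ := ((eventually_all.2 h).and (eventually_ge_atTop 0)).exists
  exact ⟨K, hK0, hK⟩

/-- Static prices lose at most of the order of `√θ` against the fluid value. -/
lemma IsRegular.exists_abs_sub_le_sqrt (hM : M.IsRegular) {z : FluidPoint E}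
    (hz : M.FluidFeasible z) :
    ∃ C : ℝ, ∀ θ : ℝ, 1 ≤ θ → ∀ γ : ℝ,
      Tendsto (fun t => ∫ τ, (M.scale θ).expectedProfit (M.shipperPrice z) (M.carrierPrice z) τ
        ∂((M.scale θ).stateLaw (M.shipperPrice z) (M.carrierPrice z) 0 t)) atTop (𝓝 γ) →
      |θ * M.fluidObjective z - γ| ≤ C * √θ := by
  obtain ⟨η, hη0, hη1, hη⟩ := exists_pos_le_one_mul_le (a := z.lam) hM.arrival_pos
  -- With `s = 1/√θ` and demand `θ d`, the exponent `θ d · 2 s²` equals `2 d`, free of `θ`. The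
  -- excess `√θ exp (2 d)` is then at most `η κ (θ y)` for `κ = K / √θ`.
  obtain ⟨K, hK0, hK⟩ := exists_nonneg_le_mul (fun e => Real.exp (2 * z.d e)) (fun e => η * z.y e)
  refine ⟨K * ∑ e, |M.penalty e - M.carrierPrice z e| * z.y e, fun θ hθ γ hγ => ?_⟩
  have hθ0 : 0 < θ := by linarith
  have hsq : 0 < √θ := Real.sqrt_pos.2 hθ0
  have hsqθ : √θ * √θ = θ := Real.mul_self_sqrt hθ0.le
  have hdem (e : E) : (M.scale θ).demand e (M.shipperPrice z e) = θ * z.d e := by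
    change θ * M.demand e (M.shipperPrice z e) = _
    rw [demand_shipperPrice hz]
  have h := (hM.isFluidEquilibrium_scale hz hθ0).abs_sub_limit_le (hM.scale hθ0) (s := (√θ)⁻¹)
    (η := η) (κ := K / √θ) (γ := γ) (inv_pos.2 hsq)
    (inv_le_one_of_one_le₀ (Real.one_le_sqrt.2 hθ)) hη0 hη1 (by positivity) ?_ ?_ hγ
  · have hV : ∑ e, (M.shipperPrice z e * (M.scale θ).demand e (M.shipperPrice z e)
        - M.carrierPrice z e * (θ * z.y e) - (M.scale θ).penalty e
          * ((M.scale θ).demand e (M.shipperPrice z e) - θ * z.y e))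
        = θ * M.fluidObjective z := by
      rw [fluidObjective, Finset.mul_sum]
      refine Finset.sum_congr rfl fun e _ => ?_
      rw [hdem]
      simp only [shipperPrice, carrierPrice, FreightMarket.scale]
      ring
    have hS : K / √θ * ∑ e, |(M.scale θ).penalty e - M.carrierPrice z e| * (θ * z.y e)
        = (K * ∑ e, |M.penalty e - M.carrierPrice z e| * z.y e) * √θ := by
      simp_rw [mul_left_comm _ θ]
      rw [← Finset.mul_sum]
      change K / √θ * (θ * ∑ e, |M.penalty e - M.carrierPrice z e| * z.y e) = _
      nth_rewrite 2 [← hsqθ]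
      field_simp
    rwa [hV, hS] at h
  · intro e
    change η * (θ * z.lam e) ≤ θ * M.arrival e
    rw [mul_left_comm]
    exact mul_le_mul_of_nonneg_left (hη e) hθ0.le
  · intro e hy
    have hy' : 0 < z.y e := (mul_pos_iff_of_pos_left hθ0).1 hy
    have h1 := mul_le_mul_of_nonneg_left (hK e (mul_pos hη0 hy')) hsq.le
    rw [hdem, inv_inv]
    have h2 : θ * z.d e * (2 * (√θ)⁻¹ ^ 2) = 2 * z.d e := by
      rw [inv_pow, Real.sq_sqrt hθ0.le]; field_simp
    have h3 : η * (K / √θ) * (θ * z.y e) = √θ * (K * (η * z.y e)) := by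
      nth_rewrite 2 [← hsqθ]
      field_simp
    rw [h2, h3]
    exact h1

end FreightMarket

theorem theorem2 {n : ℕ} {E : Finset (Fin n × Fin n)} (M : FreightMarket E) (hM : M.IsRegular)
    (z : FluidPoint E) (hz : M.IsFluidOptimal z) (hpos : 0 < M.fluidValue) :
    ∃ γSP : ℕ → ℝ,
      (∀ θ : ℕ, 1 ≤ θ →
        (M.scale θ).IsLongRunAverageProfit (M.shipperPrice z) (M.carrierPrice z) (γSP θ)) ∧
      (∃ C : ℝ, ∀ θ : ℕ, 1 ≤ θ → (M.scale θ).fluidValue - γSP θ ≤ C * √(θ : ℝ)) ∧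
      (fun θ : ℕ => 1 - γSP θ / (M.scale θ).fluidValue) =O[atTop]
        (fun θ : ℕ => 1 / √(θ : ℝ)) ∧
      Tendsto (fun θ : ℕ => γSP θ / (M.scale θ).fluidValue) atTop (𝓝 1) := by
  have hθ (θ : ℕ) (h : 1 ≤ θ) : (1 : ℝ) ≤ θ := by exact_mod_cast h
  have hlim (θ : ℕ) : ∃ γ : ℝ, 1 ≤ θ → ∀ σ, Tendsto (fun t =>
      ∫ τ, (M.scale θ).expectedProfit (M.shipperPrice z) (M.carrierPrice z) τ
        ∂((M.scale θ).stateLaw (M.shipperPrice z) (M.carrierPrice z) σ t)) atTop (𝓝 γ) := by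
    by_cases h : 1 ≤ θ
    · exact ((hM.scale (by linarith [hθ θ h])).exists_tendsto_expectedProfit _ _).imp
        fun γ hγ _ => hγ
    -- The value at `θ = 0` is arbitrary.
    · exact ⟨0, fun h' => absurd h' h⟩
  choose γSP hγ using hlim
  obtain ⟨C, hC⟩ := hM.exists_abs_sub_le_sqrt hz.1
  rw [hz.fluidValue_eq] at hpos
  set V := M.fluidObjective z
  have hFA (θ : ℕ) (h : 1 ≤ θ) : (M.scale θ).fluidValue = θ * V :=
    hz.fluidValue_scale hM (by linarith [hθ θ h])
  have hgap (θ : ℕ) (h : 1 ≤ θ) : |θ * V - γSP θ| ≤ C * √(θ : ℝ) :=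
    hC θ (hθ θ h) _ (hγ θ h 0)
  have hO : (fun θ : ℕ => 1 - γSP θ / (M.scale θ).fluidValue) =O[atTop]
      (fun θ : ℕ => 1 / √(θ : ℝ)) := by
    refine IsBigO.of_bound (C / V) ?_
    filter_upwards [eventually_ge_atTop 1] with θ h
    have hθ0 : (0 : ℝ) < θ := by linarith [hθ θ h]
    have hsq : 0 < √(θ : ℝ) := Real.sqrt_pos.2 hθ0
    have hsqθ : √(θ : ℝ) * √(θ : ℝ) = θ := Real.mul_self_sqrt hθ0.le
    have hpos' : 0 < θ * V := mul_pos hθ0 hpos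
    rw [hFA θ h, Real.norm_eq_abs, Real.norm_of_nonneg (by positivity), one_sub_div hpos'.ne',
      abs_div, abs_of_pos hpos', div_le_iff₀ hpos']
    refine (hgap θ h).trans_eq ?_
    nth_rewrite 3 [← hsqθ]
    field_simp
  refine ⟨γSP, fun θ h => (hM.scale (by linarith [hθ θ h])).isLongRunAverageProfit (hγ θ h),
    ⟨C, fun θ h => hFA θ h ▸ (le_abs_self _).trans (hgap θ h)⟩, hO, ?_⟩
  have h0 : Tendsto (fun θ : ℕ => 1 / √(θ : ℝ)) atTop (𝓝 0) :=
    (tendsto_const_nhds (x := (1 : ℝ))).div_atTop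
      (Real.tendsto_sqrt_atTop.comp tendsto_natCast_atTop_atTop)
  simpa using (hO.trans_tendsto h0).const_sub 1
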